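/- Let $R$ be a commutative ring, $H$ an $R$-bialgebra, $A$ a right $H$-comodule algebra with coaction $a\mapsto\sum a_{<0>}\otimes a_{<1>}$, and $C$ an $R$-coalgebra. If $C$ is a right $H$-module coalgebra, $(H,A,C)$ is called a right-right Doi-Koppinen structure, and $\mathcal M(H)_A^C$ is the category of right $A$-modules $M$ that are also (counital) right $C$-comodules with $\varrho(ma)=\sum m_{<0>}a_{<0>}\otimes m_{<1>}a_{<1>}$; if $C$ is a left $H$-module coalgebra, $(H,A,C)$ is called a left-right Doi-Koppinen structure, and ${}_A\mathcal M(H)^C$ is the category of left $A$-modules $M$ that are also right $C$-comodules with $\varrho(am)=\sum a_{<0>}m_{<0>}\otimes a_{<1>}m_{<1>}$. Morphisms are the $A$-linear $C$-colinear maps. In the left-right case $(H^{op},A^{op},C)$ is a right-right structure. Let $C^*=\mathrm{Hom}_R(C,R)$ with $(f\star g)(c)=\sum f(c_1)g(c_2)$, and let $C^\Box=\mathrm{Rat}^C({}_{C^*}C^*)$ be the set of $g\in C^*$ for which there is $\sum g_i\otimes c_i\in C^*\otimes_R C$ with $f\star g=\sum f(c_i)g_i$ for all $f\in C^*$. Assume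 that ${}_RC$ is locally projective, that $C$ is left coproper (for all $f\in C^*$ and finite $F\subseteq C$ some $g\in C^\Box$ agrees with $f$ on $F$), and that $C^\Box\subseteq C^*$ is $A$-pure ($A\otimes_RC^\Box\to A\otimes_RC^*$ is injective). For a right-right structure, let $A\#^{op}C^\Box=A\otimes_RC^\Box$ be the (in general non-unital) $R$-algebra with product $(a\#f)(b\#g)=\sum a_{<0>}b\#(a_{<1>}g)\star f$, where $(hg)(c)=g(ch)$. Let $\mathcal C=A\otimes_RC$ be the $A$-coring with $b(a\otimes c)=ba\otimes c$, $(b\otimes c)a=\sum ba_{<0>}\otimes ca_{<1>}$, $\Delta(a\otimes c)=\sum(a\otimes c_1)\otimes_A(1\otimes c_2)$ and $\varepsilon(a\otimes c)=a\,\varepsilon_C(c)$, let ${}^*\mathcal C=\mathrm{Hom}_{A-}(\mathcal C,A)$ with product $(f\star g)(d)=\sum g(d_1f(d_2))$, and let ${}^\Box\mathcal C=\mathrm{Rat}^{\mathcal C}({}^*\mathcal C_{{}^*\mathcal C})$ be the set of $f\in{}^*\mathcal C$ for which there is $\sum f_i\otimes d_i\in{}^*\mathcal C\otimes_A\mathcal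 C$ with $f\star g=\sum f_i\,g(d_i)$ for all $g\in{}^*\mathcal C$. In the left-right case let $A\#C^\Box=(A^{op}\#^{op}C^\Box)^{op}$, and let $\mathcal D=A^{op}\otimes_RC$ be the $A^{op}$-coring of $(H^{op},A^{op},C)$. For a possibly non-unital $R$-algebra $T$, write $\mathcal M_T$ (resp. ${}_T\mathcal M$) for the category of right (resp. left) $T$-modules $M$ with $MT=M$ (resp. $TM=M$), that is, $R$-modules with an associative $R$-bilinear action of $T$. Then, for every right-right Doi-Koppinen structure as above, $$\mathcal M(H)_A^C=\mathcal M_{A\#^{op}C^\Box}=\mathcal M_{{}^\Box\mathcal C},$$ i.e. each $M\in\mathcal M(H)_A^C$ is a unital module via $m(a\#f)=\sum f(m_{<1>})\,m_{<0>}a$, resp. $mf=\sum m_{<0>}f(1\otimes m_{<1>})$, and these assignments (identity on underlying $R$-modules and maps) are isomorphisms of categories. For every left-right Doi-Koppinen structure as above, $${}_A\mathcal M(H)^C\simeq{}_{A\#C^\Box}\mathcal M\simeq{}_{({}^\Box\mathcal D)^{op}}\mathcal M$$ are isomorphisms of categories, via $(a\#f)m=\sum f(m_{<1>})\,a\,m_{<0>}$,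 resp. $fm=\sum f(1\otimes m_{<1>})\,m_{<0>}$. -/

import Mathlib

open scoped TensorProduct

universe u₁ u₂ u₃ u₄ w

namespace DoiKoppinen

open TensorProduct CategoryTheory

noncomputable section

/-! ### Locally projective modules, rational submodules, density -/

/-- A module `W` is locally projective (Zimmermann-Huisgen) if for every finitely generated
submodule `F` of `W`, every surjection `π : L → N` and every `g : W → N` there is `g' : W → L`
such that `π ∘ g'` and `g` agree on `F`. -/
def IsLocallyProjective (R : Type u₁) (W : Type u₂) [CommRing R] [AddCommGroup W] [Module R W] :
    Prop :=
  ∀ (F : Submodule R W), F.FG →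
    ∀ (L N : Type (max u₁ u₂)) [AddCommGroup L] [AddCommGroup N] [Module R L] [Module R N]
      (π : L →ₗ[R] N), Function.Surjective π →
      ∀ g : W →ₗ[R] N, ∃ g' : W →ₗ[R] L, ∀ x ∈ F, π (g' x) = g x

section Coalgebra

variable (R : Type u₁) (C : Type u₄) [CommRing R] [AddCommGroup C] [Module R C] [Coalgebra R C]

/-- The dual algebra `C* = Hom_R(C, R)` with the convolution product
`(f ⋆ g)(c) = ∑ f(c₁) g(c₂)` and unit the counit. -/
abbrev Dual : Type (max u₁ u₄) := WithConv (C →ₗ[R] R)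

variable {R C}

/-- `∑ fᵢ ⊗ cᵢ ↦ ∑ f(cᵢ) fᵢ`. -/
def dualEval (f : Dual R C) : Dual R C ⊗[R] C →ₗ[R] Dual R C :=
  TensorProduct.lift (LinearMap.mk₂ R (fun (g : Dual R C) (c : C) => (f c) • g)
    (fun _ _ _ => smul_add _ _ _) (fun r g c => smul_comm _ _ _)
    (fun g c d => by
      change f.ofConv (c + d) • g = f.ofConv c • g + f.ofConv d • g
      rw [map_add, add_smul])
    (fun r g c => by
      change f.ofConv (r • c) • g = r • f.ofConv c • g
      rw [map_smul, smul_assoc]))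

variable (R C)

/-- `C^□`, the rational part of `C*` regarded as a left `C*`-module: those `g` for which there is
`∑ gᵢ ⊗ cᵢ ∈ C* ⊗ C` with `f ⋆ g = ∑ f(cᵢ) gᵢ` for all `f ∈ C*`. -/
def boxDual : Submodule R (Dual R C) where
  carrier := {g | ∃ t : Dual R C ⊗[R] C, ∀ f : Dual R C, f * g = dualEval f t}
  add_mem' := by
    rintro a b ⟨s, hs⟩ ⟨t, ht⟩
    exact ⟨s + t, fun f => by rw [mul_add, hs, ht, map_add]⟩
  zero_mem' := ⟨0, fun f => by rw [mul_zero, map_zero]⟩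
  smul_mem' := by
    rintro r a ⟨s, hs⟩
    exact ⟨r • s, fun f => by rw [mul_smul_comm, hs, map_smul]⟩

/-- `C` is left coproper: `C^□` is dense in `C*` for the finite topology. -/
def IsLeftCoproper : Prop :=
  ∀ (f : Dual R C) (F : Finset C), ∃ g ∈ boxDual R C, ∀ c ∈ F, g c = f c

/-- `C^□ ⊆ C*` is `A`-pure: `A ⊗ C^□ → A ⊗ C*` is injective. -/
def IsBoxPure (A : Type u₃) [Ring A] [Algebra R A] : Prop :=
  Function.Injective (LinearMap.lTensor A (boxDual R C).subtype)

end Coalgebra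

/-! ### The opposite bialgebra -/

section Op

/-- `x ⊗ y ↦ op x ⊗ op y`. -/
def opMap (R : Type u₁) (A : Type u₃) (H : Type u₂) [CommRing R] [Ring A] [Algebra R A] [Ring H]
    [Algebra R H] : A ⊗[R] H →ₗ[R] Aᵐᵒᵖ ⊗[R] Hᵐᵒᵖ :=
  TensorProduct.map (MulOpposite.opLinearEquiv R).toLinearMap
    (MulOpposite.opLinearEquiv R).toLinearMap

@[simp] lemma opMap_tmul {R : Type u₁} {A : Type u₃} {H : Type u₂} [CommRing R] [Ring A]
    [Algebra R A] [Ring H] [Algebra R H] (a : A) (h : H) :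
    opMap R A H (a ⊗ₜ h) = MulOpposite.op a ⊗ₜ MulOpposite.op h := rfl

lemma opMap_mul {R : Type u₁} {A : Type u₃} {H : Type u₂} [CommRing R] [Ring A]
    [Algebra R A] [Ring H] [Algebra R H] (x y : A ⊗[R] H) :
    opMap R A H (x * y) = opMap R A H y * opMap R A H x := by
  induction x with
  | zero => simp
  | add x x' hx hx' => rw [add_mul, map_add, hx, hx', map_add, mul_add]
  | tmul a h =>
    induction y with
    | zero => simp
    | add y y' hy hy' => rw [mul_add, map_add, hy, hy', map_add, add_mul]
    | tmul b k => simp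

variable {R : Type u₁} {H : Type u₂} [CommRing R] [Ring H] [Bialgebra R H]

lemma comul_op (h : H) : Coalgebra.comul (R := R) (MulOpposite.op h) =
    opMap R H H (Coalgebra.comul h) := rfl

lemma counit_op (h : H) : Coalgebra.counit (R := R) (MulOpposite.op h) =
    Coalgebra.counit (R := R) h := rfl

/-- The opposite bialgebra: opposite multiplication, same comultiplication. -/
instance opBialgebra : Bialgebra R Hᵐᵒᵖ :=
  Bialgebra.mk' R Hᵐᵒᵖ
    (by change Coalgebra.counit (R := R) (1 : H) = 1; exact Bialgebra.counit_one)
    (fun {a b} => by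
      change Coalgebra.counit (R := R) (b.unop * a.unop) =
        Coalgebra.counit (R := R) a.unop * Coalgebra.counit (R := R) b.unop
      rw [Bialgebra.counit_mul, mul_comm])
    (by
      change opMap R H H (Coalgebra.comul (1 : H)) = 1
      rw [Bialgebra.comul_one]; rfl)
    (fun {a b} => by
      change opMap R H H (Coalgebra.comul (b.unop * a.unop)) =
        opMap R H H (Coalgebra.comul a.unop) * opMap R H H (Coalgebra.comul b.unop)
      rw [Bialgebra.comul_mul, opMap_mul])

end Op

/-! ### Doi-Koppinen structures -/

section Structures

variable (R : Type u₁) (H : Type u₂) (A : Type u₃) (C : Type u₄) [CommRing R]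
  [Ring H] [Bialgebra R H] [Ring A] [Algebra R A] [AddCommGroup C] [Module R C] [Coalgebra R C]

/-- A right `H`-comodule algebra structure on `A`. -/
structure RightComoduleAlgebra where
  /-- the coaction `a ↦ ∑ a₀ ⊗ a₁`, an algebra morphism -/
  coact : A →ₐ[R] A ⊗[R] H
  coassoc : ∀ a, TensorProduct.assoc R A H H (LinearMap.rTensor H coact.toLinearMap (coact a)) =
    LinearMap.lTensor A Coalgebra.comul (coact a)
  counit : ∀ a, LinearMap.lTensor A Coalgebra.counit (coact a) = a ⊗ₜ[R] (1 : R)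

/-- A right `H`-module coalgebra structure on `C`. -/
structure RightModuleCoalgebra where
  /-- the right action `(c, h) ↦ c h` -/
  act : C →ₗ[R] H →ₗ[R] C
  act_one : ∀ c, act c 1 = c
  act_mul : ∀ c h k, act c (h * k) = act (act c h) k
  comul_act : ∀ c h, Coalgebra.comul (R := R) (act c h) =
    TensorProduct.map₂ act act (Coalgebra.comul c) (Coalgebra.comul h)
  counit_act : ∀ c h, Coalgebra.counit (R := R) (act c h) =
    Coalgebra.counit c * Coalgebra.counit h

/-- A left `H`-module coalgebra structure on `C`. -/
structure LeftModuleCoalgebra where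
  /-- the left action `(h, c) ↦ h c` -/
  act : H →ₗ[R] C →ₗ[R] C
  one_act : ∀ c, act 1 c = c
  mul_act : ∀ h k c, act (h * k) c = act h (act k c)
  comul_act : ∀ h c, Coalgebra.comul (R := R) (act h c) =
    TensorProduct.map₂ act act (Coalgebra.comul h) (Coalgebra.comul c)
  counit_act : ∀ h c, Coalgebra.counit (R := R) (act h c) =
    Coalgebra.counit h * Coalgebra.counit c

/-- A right-right Doi-Koppinen structure `(H, A, C)`. -/
structure RightRight where
  alg : RightComoduleAlgebra R H A
  coalg : RightModuleCoalgebra R H C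

/-- A left-right Doi-Koppinen structure `(H, A, C)`. -/
structure LeftRight where
  alg : RightComoduleAlgebra R H A
  coalg : LeftModuleCoalgebra R H C

end Structures

section OpStructure

variable {R : Type u₁} {H : Type u₂} {A : Type u₃} {C : Type u₄} [CommRing R]
  [Ring H] [Bialgebra R H] [Ring A] [Algebra R A] [AddCommGroup C] [Module R C] [Coalgebra R C]

/-- `Aᵒᵖ` is a right `Hᵒᵖ`-comodule algebra, with the same coaction as `A`. -/
def RightComoduleAlgebra.op (S : RightComoduleAlgebra R H A) :
    RightComoduleAlgebra R Hᵐᵒᵖ Aᵐᵒᵖ where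
  coact := AlgHom.ofLinearMap
    (opMap R A H ∘ₗ S.coact.toLinearMap ∘ₗ (MulOpposite.opLinearEquiv R).symm.toLinearMap)
    (by simp; rfl)
    (fun x y => by simp [opMap_mul])
  coassoc a := by
    have h := congrArg (TensorProduct.map (MulOpposite.opLinearEquiv R (M := A)).toLinearMap
      (opMap R H H)) (S.coassoc a.unop)
    unfold opMap at h
    rw [TensorProduct.map_map_assoc, LinearMap.map_rTensor, LinearMap.map_lTensor] at h
    change TensorProduct.assoc R Aᵐᵒᵖ Hᵐᵒᵖ Hᵐᵒᵖ (LinearMap.rTensor _ _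
      (opMap R A H (S.coact a.unop))) = LinearMap.lTensor _ _ (opMap R A H (S.coact a.unop))
    unfold opMap
    rw [LinearMap.rTensor_map, LinearMap.lTensor_map]
    exact h
  counit a := by
    have h := congrArg (LinearMap.rTensor R (MulOpposite.opLinearEquiv R (M := A)).toLinearMap)
      (S.counit a.unop)
    rw [LinearMap.rTensor, LinearMap.map_lTensor] at h
    change LinearMap.lTensor _ _ (opMap R A H (S.coact a.unop)) = _
    unfold opMap
    rw [LinearMap.lTensor_map]
    exact h

/-- A left `H`-module coalgebra is a right `Hᵒᵖ`-module coalgebra. -/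
def LeftModuleCoalgebra.op (S : LeftModuleCoalgebra R H C) : RightModuleCoalgebra R Hᵐᵒᵖ C where
  act := (S.act ∘ₗ (MulOpposite.opLinearEquiv R).symm.toLinearMap).flip
  act_one c := S.one_act c
  act_mul c h k := S.mul_act k.unop h.unop c
  comul_act c h := by
    refine (S.comul_act h.unop c).trans ?_
    change _ = TensorProduct.map₂ _ _ _ (opMap R H H (Coalgebra.comul h.unop))
    generalize Coalgebra.comul (R := R) h.unop = x
    generalize Coalgebra.comul (R := R) c = y
    induction x with
    | zero => simp
    | add x x' hx hx' => simp only [map_add, hx, hx', LinearMap.add_apply]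
    | tmul a h =>
      induction y with
      | zero => simp
      | add y y' hy hy' => simp only [map_add, hy, hy', LinearMap.add_apply]
      | tmul b k => simp
  counit_act c h := (S.counit_act h.unop c).trans (mul_comm _ _)

/-- The right-right Doi-Koppinen structure `(Hᵒᵖ, Aᵒᵖ, C)` of a left-right one. -/
def LeftRight.op (S : LeftRight R H A C) : RightRight R Hᵐᵒᵖ Aᵐᵒᵖ C where
  alg := S.alg.op
  coalg := S.coalg.op

end OpStructure

/-! ### Doi-Koppinen modules -/

section Modules

variable {R : Type u₁} {H : Type u₂} {A : Type u₃} {C : Type u₄} [CommRing R]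
  [Ring H] [Bialgebra R H] [Ring A] [Algebra R A] [AddCommGroup C] [Module R C] [Coalgebra R C]

/-- The objects of `M(H)_A^C`: right `A`-modules and right `C`-comodules `M` with
`ϱ(m a) = ∑ m₀ a₀ ⊗ m₁ a₁`. -/
structure RRModule (S : RightRight R H A C) where
  carrier : Type w
  [addCommGroup : AddCommGroup carrier]
  [module : Module R carrier]
  /-- the right action `(m, a) ↦ m a` -/
  act : carrier →ₗ[R] A →ₗ[R] carrier
  act_one : ∀ m, act m 1 = m
  act_mul : ∀ m a b, act m (a * b) = act (act m a) b
  /-- the coaction `m ↦ ∑ m₀ ⊗ m₁` -/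
  coact : carrier →ₗ[R] carrier ⊗[R] C
  coassoc : ∀ m, TensorProduct.assoc R carrier C C (LinearMap.rTensor C coact (coact m)) =
    LinearMap.lTensor carrier Coalgebra.comul (coact m)
  counit : ∀ m, LinearMap.lTensor carrier Coalgebra.counit (coact m) = m ⊗ₜ[R] (1 : R)
  compat : ∀ m a, coact (act m a) = TensorProduct.map₂ act S.coalg.act (coact m) (S.alg.coact a)

attribute [instance] RRModule.addCommGroup RRModule.module

/-- The objects of `_A M(H)^C`: left `A`-modules and right `C`-comodules `M` with
`ϱ(a m) = ∑ a₀ m₀ ⊗ a₁ m₁`. -/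
structure LRModule (S : LeftRight R H A C) where
  carrier : Type w
  [addCommGroup : AddCommGroup carrier]
  [module : Module R carrier]
  /-- the left action `(a, m) ↦ a m` -/
  act : A →ₗ[R] carrier →ₗ[R] carrier
  one_act : ∀ m, act 1 m = m
  mul_act : ∀ a b m, act (a * b) m = act a (act b m)
  /-- the coaction `m ↦ ∑ m₀ ⊗ m₁` -/
  coact : carrier →ₗ[R] carrier ⊗[R] C
  coassoc : ∀ m, TensorProduct.assoc R carrier C C (LinearMap.rTensor C coact (coact m)) =
    LinearMap.lTensor carrier Coalgebra.comul (coact m)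
  counit : ∀ m, LinearMap.lTensor carrier Coalgebra.counit (coact m) = m ⊗ₜ[R] (1 : R)
  compat : ∀ a m, coact (act a m) = TensorProduct.map₂ act S.coalg.act (S.alg.coact a) (coact m)

attribute [instance] LRModule.addCommGroup LRModule.module

/-- `A`-linear `C`-colinear maps. -/
@[ext] structure RRModule.Hom {S : RightRight R H A C} (M N : RRModule.{u₁, u₂, u₃, u₄, w} S) where
  toLin : M.carrier →ₗ[R] N.carrier
  map_act : ∀ m a, toLin (M.act m a) = N.act (toLin m) a
  map_coact : ∀ m, N.coact (toLin m) = LinearMap.rTensor C toLin (M.coact m)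

/-- `A`-linear `C`-colinear maps. -/
@[ext] structure LRModule.Hom {S : LeftRight R H A C} (M N : LRModule.{u₁, u₂, u₃, u₄, w} S) where
  toLin : M.carrier →ₗ[R] N.carrier
  map_act : ∀ a m, toLin (M.act a m) = N.act a (toLin m)
  map_coact : ∀ m, N.coact (toLin m) = LinearMap.rTensor C toLin (M.coact m)

/-- The category `M(H)_A^C`. -/
instance RRModule.category (S : RightRight R H A C) :
    Category (RRModule.{u₁, u₂, u₃, u₄, w} S) where
  Hom := RRModule.Hom
  id M := ⟨LinearMap.id, fun _ _ => rfl, fun m => by simp⟩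
  comp f g := ⟨g.toLin ∘ₗ f.toLin, fun m a => by simp [f.map_act, g.map_act],
    fun m => by simp [f.map_coact, g.map_coact, LinearMap.rTensor_comp]⟩

/-- The category `_A M(H)^C`. -/
instance LRModule.category (S : LeftRight R H A C) :
    Category (LRModule.{u₁, u₂, u₃, u₄, w} S) where
  Hom := LRModule.Hom
  id M := ⟨LinearMap.id, fun _ _ => rfl, fun m => by simp⟩
  comp f g := ⟨g.toLin ∘ₗ f.toLin, fun m a => by simp [f.map_act, g.map_act],
    fun m => by simp [f.map_coact, g.map_coact, LinearMap.rTensor_comp]⟩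

/-- A left-right Doi-Koppinen module over `(H, A, C)` is a right-right one over
`(Hᵒᵖ, Aᵒᵖ, C)`. -/
def LRModule.op {S : LeftRight R H A C} (M : LRModule.{u₁, u₂, u₃, u₄, w} S) :
    RRModule.{u₁, u₂, u₃, u₄, w} S.op where
  carrier := M.carrier
  act := (M.act ∘ₗ (MulOpposite.opLinearEquiv R).symm.toLinearMap).flip
  act_one m := M.one_act m
  act_mul m a b := M.mul_act b.unop a.unop m
  coact := M.coact
  coassoc := M.coassoc
  counit := M.counit
  compat m a := by
    refine (M.compat a.unop m).trans ?_
    change _ = TensorProduct.map₂ _ _ _ (opMap R A H (S.alg.coact a.unop))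
    generalize S.alg.coact a.unop = x
    generalize M.coact m = y
    induction x with
    | zero => simp
    | add x x' hx hx' => simp only [map_add, hx, hx', LinearMap.add_apply]
    | tmul a h =>
      induction y with
      | zero => simp
      | add y y' hy hy' => simp only [map_add, hy, hy', LinearMap.add_apply]
      | tmul b k => simp [LeftRight.op, LeftModuleCoalgebra.op]

/-- The functor `_A M(H)^C ⥤ M(Hᵒᵖ)_{Aᵒᵖ}^C`. -/
def LRModule.opFunctor (S : LeftRight R H A C) :
    LRModule.{u₁, u₂, u₃, u₄, w} S ⥤ RRModule.{u₁, u₂, u₃, u₄, w} S.op where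
  obj M := M.op
  map f := ⟨f.toLin, fun m a => f.map_act a.unop m, f.map_coact⟩

end Modules

/-! ### Modules over rings without unit -/

section NonUnital

variable (R : Type u₁) (T : Type u₂) [CommRing R] [NonUnitalRing T] [Module R T]

/-- Right modules over the `R`-algebra `T`, which need not have a unit. -/
structure RMod where
  carrier : Type w
  [addCommGroup : AddCommGroup carrier]
  [module : Module R carrier]
  /-- the right action `(m, t) ↦ m t` -/
  act : carrier →ₗ[R] T →ₗ[R] carrier
  act_mul : ∀ m s t, act m (s * t) = act (act m s) t

/-- Left modules over the `R`-algebra `T`, which need not have a unit. -/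
structure LMod where
  carrier : Type w
  [addCommGroup : AddCommGroup carrier]
  [module : Module R carrier]
  /-- the left action `(t, m) ↦ t m` -/
  act : T →ₗ[R] carrier →ₗ[R] carrier
  mul_act : ∀ s t m, act (s * t) m = act s (act t m)

attribute [instance] RMod.addCommGroup RMod.module LMod.addCommGroup LMod.module

variable {R T}

/-- `T`-linear maps. -/
@[ext] structure RMod.Hom (M N : RMod.{u₁, u₂, w} R T) where
  toLin : M.carrier →ₗ[R] N.carrier
  map_act : ∀ m t, toLin (M.act m t) = N.act (toLin m) t

/-- `T`-linear maps. -/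
@[ext] structure LMod.Hom (M N : LMod.{u₁, u₂, w} R T) where
  toLin : M.carrier →ₗ[R] N.carrier
  map_act : ∀ t m, toLin (M.act t m) = N.act t (toLin m)

instance RMod.category : Category (RMod.{u₁, u₂, w} R T) where
  Hom := RMod.Hom
  id M := ⟨LinearMap.id, fun _ _ => rfl⟩
  comp f g := ⟨g.toLin ∘ₗ f.toLin, fun m a => by simp [f.map_act, g.map_act]⟩

instance LMod.category : Category (LMod.{u₁, u₂, w} R T) where
  Hom := LMod.Hom
  id M := ⟨LinearMap.id, fun _ _ => rfl⟩
  comp f g := ⟨g.toLin ∘ₗ f.toLin, fun m a => by simp [f.map_act, g.map_act]⟩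

variable (R T)

/-- `M` is unital: `M T = M`. -/
def RMod.IsUnital : ObjectProperty (RMod.{u₁, u₂, w} R T) := fun M =>
  Submodule.span R {x | ∃ m t, M.act m t = x} = ⊤

/-- `M` is unital: `T M = M`. -/
def LMod.IsUnital : ObjectProperty (LMod.{u₁, u₂, w} R T) := fun M =>
  Submodule.span R {x | ∃ t m, M.act t m = x} = ⊤

/-- The category `M_T` of unital right `T`-modules. -/
abbrev UnitalRMod := (RMod.IsUnital.{u₁, u₂, w} R T).FullSubcategory

/-- The category `_T M` of unital left `T`-modules. -/
abbrev UnitalLMod := (LMod.IsUnital.{u₁, u₂, w} R T).FullSubcategory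

/-- A right `T`-module is a left `Tᵒᵖ`-module. -/
def RMod.opFunctor : RMod.{u₁, u₂, w} R T ⥤ LMod.{u₁, u₂, w} R Tᵐᵒᵖ where
  obj M :=
    { carrier := M.carrier
      act := M.act.flip ∘ₗ (MulOpposite.opLinearEquiv R).symm.toLinearMap
      mul_act := fun s t m => M.act_mul m t.unop s.unop }
  map f := ⟨f.toLin, fun t m => f.map_act m t.unop⟩

end NonUnital

/-- `F` is an isomorphism of categories. -/
def IsIsoOfCategories {𝒳 𝒴 : Type*} [Category 𝒳] [Category 𝒴] (F : 𝒳 ⥤ 𝒴) : Prop :=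
  ∃ G : 𝒴 ⥤ 𝒳, F ⋙ G = 𝟭 𝒳 ∧ G ⋙ F = 𝟭 𝒴

/-! ### The coring `𝒞 = A ⊗ C`, its left dual ring and `^□𝒞` -/

section Coring

variable {R : Type u₁} {H : Type u₂} {A : Type u₃} {C : Type u₄} [CommRing R]
  [Ring H] [Bialgebra R H] [Ring A] [Algebra R A] [AddCommGroup C] [Module R C] [Coalgebra R C]

namespace RightRight

/-- The right `A`-action of the `A`-coring `𝒞 = A ⊗ C`: `(b ⊗ c) a = ∑ b a₀ ⊗ c a₁`. The left
`A`-action is `b (a ⊗ c) = b a ⊗ c`. -/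
def coringAct (S : RightRight R H A C) : A ⊗[R] C →ₗ[R] A →ₗ[R] A ⊗[R] C :=
  (TensorProduct.map₂ (LinearMap.mul R A) S.coalg.act).compl₂ S.alg.coact.toLinearMap

/-- The comultiplication `a ⊗ c ↦ ∑ (a ⊗ c₁) ⊗_A (1 ⊗ c₂)` of the coring `𝒞 = A ⊗ C`, with the
indicated representative in `𝒞 ⊗_R 𝒞`. -/
def coringComul (_ : RightRight R H A C) : A ⊗[R] C →ₗ[R] (A ⊗[R] C) ⊗[R] (A ⊗[R] C) :=
  LinearMap.lTensor (A ⊗[R] C) (TensorProduct.mk R A C 1) ∘ₗ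
    (TensorProduct.assoc R A C C).symm.toLinearMap ∘ₗ LinearMap.lTensor A Coalgebra.comul

/-- The left dual `*𝒞` of the `A`-coring `𝒞 = A ⊗ C`: the left `A`-linear maps `𝒞 → A`. -/
def LeftDual (_ : RightRight R H A C) : Type (max u₃ u₄) := A ⊗[R] C →ₗ[A] A

variable (S : RightRight R H A C)

instance : AddCommGroup S.LeftDual := inferInstanceAs (AddCommGroup (A ⊗[R] C →ₗ[A] A))
instance : Module R S.LeftDual := inferInstanceAs (Module R (A ⊗[R] C →ₗ[A] A))
instance : FunLike S.LeftDual (A ⊗[R] C) A := inferInstanceAs (FunLike (A ⊗[R] C →ₗ[A] A) _ _)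
instance : LinearMapClass S.LeftDual A (A ⊗[R] C) A :=
  inferInstanceAs (LinearMapClass (A ⊗[R] C →ₗ[A] A) A _ _)

variable {S}

/-- The underlying `R`-linear map. -/
def LeftDual.lin (f : S.LeftDual) : A ⊗[R] C →ₗ[R] A :=
  LinearMap.restrictScalars R (f : A ⊗[R] C →ₗ[A] A)

@[simp] lemma LeftDual.lin_apply (f : S.LeftDual) (d : A ⊗[R] C) : f.lin d = f d := rfl
@[simp] lemma LeftDual.add_apply (f g : S.LeftDual) (d : A ⊗[R] C) : (f + g) d = f d + g d := rfl
@[simp] lemma LeftDual.zero_apply (d : A ⊗[R] C) : (0 : S.LeftDual) d = 0 := rfl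
@[simp] lemma LeftDual.smul_apply (r : R) (f : S.LeftDual) (d : A ⊗[R] C) :
    (r • f) d = r • f d := rfl

lemma LeftDual.map_smul_left (f : S.LeftDual) (a : A) (d : A ⊗[R] C) : f (a • d) = a * f d :=
  LinearMap.map_smul (f : A ⊗[R] C →ₗ[A] A) a d

lemma LeftDual.map_smul_R (f : S.LeftDual) (r : R) (d : A ⊗[R] C) : f (r • d) = r • f d :=
  f.lin.map_smul r d

lemma LeftDual.ext {f g : S.LeftDual} (h : ∀ c, f (1 ⊗ₜ c) = g (1 ⊗ₜ c)) : f = g := by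
  refine DFunLike.ext _ _ fun d => ?_
  induction d with
  | zero => rw [map_zero, map_zero]
  | add x y hx hy => rw [map_add, map_add, hx, hy]
  | tmul a c =>
    have : a ⊗ₜ[R] c = a • ((1 : A) ⊗ₜ[R] c) := by
      rw [TensorProduct.smul_tmul', smul_eq_mul, mul_one]
    rw [this, f.map_smul_left, g.map_smul_left, h]

@[simp] lemma coringComul_tmul (a : A) (c : C) :
    S.coringComul (a ⊗ₜ c) = LinearMap.lTensor (A ⊗[R] C) (TensorProduct.mk R A C 1)
      ((TensorProduct.assoc R A C C).symm (a ⊗ₜ Coalgebra.comul c)) := rfl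

lemma coringAct_tmul (b : A) (c : C) (a : A) : S.coringAct (b ⊗ₜ c) a =
    TensorProduct.map (LinearMap.mulLeft R b) (S.coalg.act c) (S.alg.coact a) := by
  rfl

lemma coringAct_apply (d : A ⊗[R] C) (a : A) : S.coringAct d a =
    TensorProduct.map₂ (LinearMap.mul R A) S.coalg.act d (S.alg.coact a) := rfl

lemma smul_map₂ (b : A) (d : A ⊗[R] C) (t : A ⊗[R] H) :
    TensorProduct.map₂ (LinearMap.mul R A) S.coalg.act (b • d) t =
      b • TensorProduct.map₂ (LinearMap.mul R A) S.coalg.act d t := by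
  induction d with
  | zero => simp
  | add x y hx hy => simp only [smul_add, map_add, LinearMap.add_apply, hx, hy]
  | tmul a c =>
    induction t with
    | zero => simp
    | add x y hx hy => simp only [smul_add, map_add, hx, hy]
    | tmul p q => simp [TensorProduct.smul_tmul', mul_assoc]

lemma coringAct_smul (b : A) (d : A ⊗[R] C) (a : A) :
    S.coringAct (b • d) a = b • S.coringAct d a := smul_map₂ b d _

lemma coringAct_mul (d : A ⊗[R] C) (a b : A) :
    S.coringAct (S.coringAct d a) b = S.coringAct d (a * b) := by
  simp only [coringAct_apply, map_mul]
  generalize S.alg.coact a = x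
  generalize S.alg.coact b = y
  induction d with
  | zero => simp
  | add d d' hd hd' => simp only [map_add, LinearMap.add_apply, hd, hd']
  | tmul e c =>
    induction x with
    | zero => simp
    | add x x' hx hx' => simp only [map_add, LinearMap.add_apply, add_mul, hx, hx']
    | tmul p q =>
      induction y with
      | zero => simp
      | add y y' hy hy' => simp only [map_add, mul_add, hy, hy']
      | tmul r s => simp [S.coalg.act_mul, mul_assoc]

/-- `x ⊗ y ↦ x f(y)`. -/
def contract (f : S.LeftDual) : (A ⊗[R] C) ⊗[R] (A ⊗[R] C) →ₗ[R] A ⊗[R] C :=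
  TensorProduct.lift (S.coringAct.compl₂ f.lin)

@[simp] lemma contract_tmul (f : S.LeftDual) (x y : A ⊗[R] C) :
    contract f (x ⊗ₜ y) = S.coringAct x (f y) := rfl

lemma contract_comul_smul (f : S.LeftDual) (a : A) (d : A ⊗[R] C) :
    contract f (S.coringComul (a • d)) = a • contract f (S.coringComul d) := by
  induction d with
  | zero => simp
  | add x y hx hy => simp only [smul_add, map_add, hx, hy]
  | tmul b c =>
    rw [TensorProduct.smul_tmul', coringComul_tmul, coringComul_tmul]
    generalize Coalgebra.comul (R := R) c = t
    induction t with
    | zero => simp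
    | add x y hx hy => simp only [TensorProduct.tmul_add, smul_add, map_add, hx, hy]
    | tmul x y => simp [← coringAct_smul, TensorProduct.smul_tmul']

/-- The product `(f ⋆ g)(d) = ∑ g(d₁ f(d₂))` of `*𝒞`. -/
instance : Mul S.LeftDual where
  mul f g := show A ⊗[R] C →ₗ[A] A from
    { toFun := fun d => g (contract f (S.coringComul d))
      map_add' := fun x y => by simp only [map_add]
      map_smul' := fun a d => by
        rw [contract_comul_smul, g.map_smul_left]; rfl }

lemma LeftDual.mul_apply (f g : S.LeftDual) (d : A ⊗[R] C) :
    (f * g) d = g (contract f (S.coringComul d)) := rfl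

lemma contract_add (f g : S.LeftDual) (x : (A ⊗[R] C) ⊗[R] (A ⊗[R] C)) :
    contract (f + g) x = contract f x + contract g x := by
  induction x with
  | zero => simp
  | add x y hx hy => simp only [map_add, hx, hy]; abel
  | tmul x y => simp

lemma contract_zero (x : (A ⊗[R] C) ⊗[R] (A ⊗[R] C)) :
    contract (0 : S.LeftDual) x = 0 := by
  induction x with
  | zero => simp
  | add x y hx hy => simp only [map_add, hx, hy, add_zero]
  | tmul x y => simp

lemma coringComul_coassoc (d : A ⊗[R] C) :
    TensorProduct.assoc R _ _ _ (LinearMap.rTensor _ S.coringComul (S.coringComul d)) =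
      LinearMap.lTensor _ S.coringComul (S.coringComul d) := by
  induction d with
  | zero => simp
  | add x y hx hy => simp only [map_add, hx, hy]
  | tmul a c =>
    have h := Coalgebra.coassoc_apply (R := R) c
    let Θ : C ⊗[R] (C ⊗[R] C) →ₗ[R] (A ⊗[R] C) ⊗[R] ((A ⊗[R] C) ⊗[R] (A ⊗[R] C)) :=
      TensorProduct.map (TensorProduct.mk R A C a)
        (TensorProduct.map (TensorProduct.mk R A C 1) (TensorProduct.mk R A C 1))
    have h' := congrArg Θ h
    have e1 : ∀ t : C ⊗[R] C, Θ (TensorProduct.assoc R C C C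
        (LinearMap.rTensor C Coalgebra.comul t)) =
        TensorProduct.assoc R _ _ _ (LinearMap.rTensor _ S.coringComul
          (LinearMap.lTensor (A ⊗[R] C) (TensorProduct.mk R A C 1)
            ((TensorProduct.assoc R A C C).symm (a ⊗ₜ t)))) := by
      intro t
      induction t with
      | zero => simp
      | add x y hx hy => simp only [TensorProduct.tmul_add, map_add, hx, hy]
      | tmul x y =>
        simp only [LinearMap.rTensor_tmul, TensorProduct.assoc_symm_tmul, LinearMap.lTensor_tmul,
          coringComul_tmul]
        generalize Coalgebra.comul (R := R) x = s
        induction s with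
        | zero => simp
        | add u v hu hv => simp only [TensorProduct.add_tmul, TensorProduct.tmul_add, map_add,
            hu, hv]
        | tmul u v => simp [Θ]
    have e2 : ∀ t : C ⊗[R] C, Θ (LinearMap.lTensor C Coalgebra.comul t) =
        LinearMap.lTensor _ S.coringComul
          (LinearMap.lTensor (A ⊗[R] C) (TensorProduct.mk R A C 1)
            ((TensorProduct.assoc R A C C).symm (a ⊗ₜ t))) := by
      intro t
      induction t with
      | zero => simp
      | add x y hx hy => simp only [TensorProduct.tmul_add, map_add, hx, hy]
      | tmul x y =>
        simp only [TensorProduct.assoc_symm_tmul, LinearMap.lTensor_tmul, TensorProduct.mk_apply,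
          coringComul_tmul]
        generalize Coalgebra.comul (R := R) y = s
        induction s with
        | zero => simp
        | add u v hu hv => simp only [TensorProduct.tmul_add, map_add, hu, hv]
        | tmul u v => simp [Θ]
    rw [e1, e2] at h'
    exact h'

/-- The comultiplication is right `A`-linear, after contraction. -/
lemma contract_comul_act (g : S.LeftDual) (d : A ⊗[R] C) (a : A) :
    contract g (S.coringComul (S.coringAct d a)) =
      contract g (LinearMap.lTensor _ (S.coringAct.flip a) (S.coringComul d)) := by
  induction d with
  | zero => simp
  | add x y hx hy => simp only [map_add, LinearMap.add_apply, hx, hy]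
  | tmul b c =>
    let W : A ⊗[R] (C ⊗[R] C) →ₗ[R] A ⊗[R] (H ⊗[R] H) →ₗ[R] A ⊗[R] (C ⊗[R] C) :=
      TensorProduct.map₂ (LinearMap.mul R A) (TensorProduct.map₂ S.coalg.act S.coalg.act)
    let Z : A ⊗[R] (C ⊗[R] C) →ₗ[R] A ⊗[R] C :=
      contract g ∘ₗ LinearMap.lTensor (A ⊗[R] C) (TensorProduct.mk R A C 1) ∘ₗ
        (TensorProduct.assoc R A C C).symm.toLinearMap
    have e1 : ∀ t : A ⊗[R] H, LinearMap.lTensor A Coalgebra.comul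
        (TensorProduct.map₂ (LinearMap.mul R A) S.coalg.act (b ⊗ₜ c) t) =
        W (b ⊗ₜ Coalgebra.comul c) (LinearMap.lTensor A Coalgebra.comul t) := by
      intro t
      induction t with
      | zero => simp
      | add x y hx hy => simp only [map_add, hx, hy]
      | tmul x y => simp [W, S.coalg.comul_act]
    have e2 : ∀ (s : C ⊗[R] C) (t : A ⊗[R] H),
        contract g (LinearMap.lTensor _ (TensorProduct.map₂ (LinearMap.mul R A) S.coalg.act |>.flip t)
          (LinearMap.lTensor (A ⊗[R] C) (TensorProduct.mk R A C 1)
            ((TensorProduct.assoc R A C C).symm (b ⊗ₜ s)))) =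
        Z (W (b ⊗ₜ s) (TensorProduct.assoc R A H H
          (LinearMap.rTensor H S.alg.coact.toLinearMap t))) := by
      intro s t
      induction s with
      | zero => simp
      | add x y hx hy =>
        simp only [TensorProduct.tmul_add, map_add, LinearMap.add_apply, hx, hy]
      | tmul x y =>
        induction t with
        | zero => simp
        | add u v hu hv =>
          simp only [map_add, LinearMap.lTensor_add, LinearMap.add_apply, hu, hv]
        | tmul p q =>
          have hg : g ((p : A) ⊗ₜ[R] S.coalg.act y q) = p * g (1 ⊗ₜ S.coalg.act y q) := by
            rw [← g.map_smul_left, TensorProduct.smul_tmul', smul_eq_mul, mul_one]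
          simp only [TensorProduct.assoc_symm_tmul, LinearMap.lTensor_tmul, TensorProduct.mk_apply,
            LinearMap.flip_apply, TensorProduct.map₂_apply_tmul, TensorProduct.map_tmul,
            LinearMap.mul_apply', one_mul,
            contract_tmul, hg, LinearMap.rTensor_tmul]
          rw [← coringAct_mul, coringAct_apply (b ⊗ₜ x)]
          change _ = Z (W _ (TensorProduct.assoc R A H H (S.alg.coact p ⊗ₜ q)))
          generalize S.alg.coact p = r
          induction r with
          | zero => simp
          | add u v hu hv =>
            simp only [TensorProduct.add_tmul, map_add, LinearMap.add_apply, hu, hv]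
          | tmul u v => simp [Z, W]
    have h1 := e1 (S.alg.coact a)
    rw [← S.alg.coassoc a] at h1
    have h2 := e2 (Coalgebra.comul c) (S.alg.coact a)
    rw [← h1] at h2
    exact h2.symm

/-- `*𝒞` is an associative ring. -/
instance : NonUnitalRing S.LeftDual :=
  { (inferInstance : AddCommGroup S.LeftDual), (inferInstance : Mul S.LeftDual) with
    left_distrib := fun f g h => DFunLike.ext _ _ fun d => rfl
    right_distrib := fun f g h => DFunLike.ext _ _ fun d => by
      simp only [LeftDual.mul_apply, LeftDual.add_apply, contract_add, map_add]
    zero_mul := fun f => DFunLike.ext _ _ fun d => by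
      simp only [LeftDual.mul_apply, LeftDual.zero_apply, contract_zero, map_zero]
    mul_zero := fun f => DFunLike.ext _ _ fun d => rfl
    mul_assoc := fun f g h => DFunLike.ext _ _ fun d => by
      simp only [LeftDual.mul_apply]
      congr 1
      have h1 := coringComul_coassoc (S := S) d
      let Θ : (A ⊗[R] C) ⊗[R] ((A ⊗[R] C) ⊗[R] (A ⊗[R] C)) →ₗ[R] A ⊗[R] C :=
        contract g ∘ₗ LinearMap.lTensor _ (contract f)
      have e1 : ∀ x, contract (f * g) x = Θ (LinearMap.lTensor _ S.coringComul x) := by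
        intro x
        induction x with
        | zero => simp
        | add x y hx hy => simp only [map_add, hx, hy]
        | tmul x y => simp [Θ, LeftDual.mul_apply]
      have e2 : ∀ x, contract g (S.coringComul (contract f x)) =
          Θ (TensorProduct.assoc R _ _ _ (LinearMap.rTensor _ S.coringComul x)) := by
        intro x
        induction x with
        | zero => simp
        | add x y hx hy => simp only [map_add, hx, hy]
        | tmul x y =>
          rw [contract_tmul, contract_comul_act, LinearMap.rTensor_tmul]
          generalize S.coringComul x = z
          induction z with
          | zero => simp
          | add u v hu hv => simp only [TensorProduct.add_tmul, map_add, hu, hv]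
          | tmul u v => simp [Θ]
      rw [e1, e2, h1] }

/-- `∑ fᵢ ⊗ dᵢ ↦ ∑ fᵢ g(dᵢ)`, where `(f a)(d) = f(d) a`. -/
def leftDualEval (g : S.LeftDual) : S.LeftDual ⊗[R] (A ⊗[R] C) →ₗ[R] S.LeftDual :=
  TensorProduct.lift (LinearMap.mk₂ R
    (fun (f : S.LeftDual) (d : A ⊗[R] C) =>
      (show A ⊗[R] C →ₗ[A] A from
        LinearMap.toSpanSingleton A A (g d) ∘ₗ (f : A ⊗[R] C →ₗ[A] A) : S.LeftDual))
    (fun f f' d => DFunLike.ext _ _ fun x => add_mul (f x) (f' x) (g d))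
    (fun r f d => DFunLike.ext _ _ fun x => smul_mul_assoc r (f x) (g d))
    (fun f d d' => DFunLike.ext _ _ fun x => by
      change f x * g (d + d') = f x * g d + f x * g d'
      rw [map_add, mul_add])
    (fun r f d => DFunLike.ext _ _ fun x => by
      change f x * g (r • d) = r • (f x * g d)
      rw [g.map_smul_R, mul_smul_comm]))

@[simp] lemma leftDualEval_tmul (g f : S.LeftDual) (d x : A ⊗[R] C) :
    leftDualEval g (f ⊗ₜ d) x = f x * g d := rfl

variable (S)

/-- `^□𝒞`, the rational part of `*𝒞` as a right `*𝒞`-module: those `f` for which there is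
`∑ fᵢ ⊗_A dᵢ ∈ *𝒞 ⊗_A 𝒞` with `f ⋆ g = ∑ fᵢ g(dᵢ)` for all `g ∈ *𝒞`. -/
def boxLeftDual : NonUnitalSubalgebra R S.LeftDual where
  carrier := {f | ∃ t : S.LeftDual ⊗[R] (A ⊗[R] C), ∀ g : S.LeftDual, f * g = leftDualEval g t}
  add_mem' := by
    rintro a b ⟨s, hs⟩ ⟨t, ht⟩
    exact ⟨s + t, fun f => by rw [add_mul, hs, ht, map_add]⟩
  zero_mem' := ⟨0, fun f => by rw [zero_mul, map_zero]⟩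
  smul_mem' := by
    rintro r a ⟨s, hs⟩
    refine ⟨r • s, fun g => ?_⟩
    rw [map_smul, ← hs]
    refine DFunLike.ext _ _ fun d => ?_
    simp only [LeftDual.mul_apply, LeftDual.smul_apply]
    rw [← g.map_smul_R]
    congr 1
    generalize S.coringComul d = x
    induction x with
    | zero => simp
    | add x y hx hy => simp only [map_add, smul_add, hx, hy]
    | tmul x y => simp
  mul_mem' := by
    rintro a b ⟨s, hs⟩ -
    refine ⟨LinearMap.lTensor _ (contract b ∘ₗ S.coringComul) s, fun g => ?_⟩
    rw [mul_assoc, hs]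
    clear hs
    induction s with
    | zero => simp
    | add x y hx hy => simp only [map_add, hx, hy]
    | tmul x y => rfl

/-! ### The smash product `A #ᵒᵖ C^□` -/

/-- The left `H`-action on `C*`: `(h f)(c) = f(c h)`. -/
def dualAct : H →ₗ[R] Dual R C →ₗ[R] Dual R C :=
  LinearMap.mk₂ R (fun h f => WithConv.toConv (f.ofConv ∘ₗ S.coalg.act.flip h))
    (fun h k f => by ext c; simp)
    (fun r h f => by ext c; simp)
    (fun h f g => by ext c; rfl)
    (fun r h f => by ext c; rfl)

variable {S}

lemma dualAct_apply (h : H) (f : Dual R C) (c : C) : S.dualAct h f c = f (S.coalg.act c h) := rfl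

lemma dualAct_mul (h k : H) (f : Dual R C) :
    S.dualAct (h * k) f = S.dualAct h (S.dualAct k f) := by
  ext c
  exact congrArg f.ofConv (S.coalg.act_mul c h k)

lemma dualAct_conv (h : H) (f g : Dual R C) : S.dualAct h (f * g) =
    TensorProduct.lift ((LinearMap.mul R (Dual R C)).compl₁₂
      (S.dualAct.flip f) (S.dualAct.flip g)) (Coalgebra.comul h) := by
  ext c
  change LinearMap.mul' R R (TensorProduct.map f.ofConv g.ofConv
    (Coalgebra.comul (S.coalg.act c h))) = _
  rw [S.coalg.comul_act]
  generalize Coalgebra.comul (R := R) h = x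
  induction x with
  | zero => simp
  | add x y hx hy => simp only [map_add, hx, hy]; rfl
  | tmul p q =>
    change _ = LinearMap.mul' R R (TensorProduct.map (S.dualAct p f).ofConv (S.dualAct q g).ofConv
      (Coalgebra.comul c))
    generalize Coalgebra.comul (R := R) c = y
    induction y with
    | zero => simp
    | add x y hx hy => simp only [map_add, LinearMap.add_apply, hx, hy]
    | tmul u v => rfl

end RightRight

/-- `C^□` is a left ideal of `C*`. -/
lemma mul_mem_boxDual (g : Dual R C) {f : Dual R C} (hf : f ∈ boxDual R C) :
    g * f ∈ boxDual R C := by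
  obtain ⟨t, ht⟩ := hf
  -- `∑ fᵢ ⊗ cᵢ ↦ ∑ fᵢ ⊗ cᵢ₁ g(cᵢ₂)`
  refine ⟨LinearMap.lTensor _ ((TensorProduct.rid R C).toLinearMap ∘ₗ
    LinearMap.lTensor C g.ofConv ∘ₗ Coalgebra.comul) t, fun f' => ?_⟩
  rw [← mul_assoc, ht]
  clear ht
  induction t with
  | zero => simp
  | add x y hx hy => simp only [map_add, hx, hy]
  | tmul x c =>
    change (LinearMap.mul' R R (TensorProduct.map f'.ofConv g.ofConv (Coalgebra.comul c))) • x =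
      (f'.ofConv (TensorProduct.rid R C (LinearMap.lTensor C g.ofConv (Coalgebra.comul c)))) • x
    congr 1
    generalize Coalgebra.comul (R := R) c = y
    induction y with
    | zero => simp
    | add x y hx hy => simp only [map_add, hx, hy]
    | tmul u v => simp [mul_comm]

/-- The product `C* × C^□ → C^□`. -/
def mulBox : Dual R C →ₗ[R] boxDual R C →ₗ[R] boxDual R C :=
  LinearMap.mk₂ R (fun g f => ⟨g * f.1, mul_mem_boxDual g f.2⟩)
    (fun g g' f => Subtype.ext (add_mul g g' f.1))
    (fun r g f => Subtype.ext (smul_mul_assoc r g f.1))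
    (fun g f f' => Subtype.ext (mul_add g f.1 f'.1))
    (fun r g f => Subtype.ext (mul_smul_comm r g f.1))

lemma coe_mulBox (g : Dual R C) (f : boxDual R C) : (mulBox g f : Dual R C) = g * f.1 := rfl

lemma mulBox_mul (g g' : Dual R C) (f : boxDual R C) :
    mulBox (g * g') f = mulBox g (mulBox g' f) := Subtype.ext (mul_assoc g g' f.1)

namespace RightRight

variable (S : RightRight R H A C)

/-- `(h, f, g) ↦ (h g) ⋆ f` for `f ∈ C^□`. -/
def twist : H →ₗ[R] boxDual R C →ₗ[R] Dual R C →ₗ[R] boxDual R C :=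
  LinearMap.mk₂ R (fun h f => mulBox.flip f ∘ₗ S.dualAct h)
    (fun h k f => by rw [map_add, LinearMap.comp_add])
    (fun r h f => by rw [map_smul, LinearMap.comp_smul])
    (fun h f g => by rw [map_add, LinearMap.add_comp])
    (fun r h f => by rw [map_smul, LinearMap.smul_comp])

/-- The underlying `R`-module `A ⊗ C^□` of the smash product `A #ᵒᵖ C^□`. -/
def OpSmash (_ : RightRight R H A C) : Type (max u₁ u₃ u₄) := A ⊗[R] boxDual R C

instance : AddCommGroup S.OpSmash := inferInstanceAs (AddCommGroup (A ⊗[R] boxDual R C))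
instance : Module R S.OpSmash := inferInstanceAs (Module R (A ⊗[R] boxDual R C))

/-- `(x ⊗ h) # f, b # g ↦ x b # (h g) ⋆ f`. -/
def smashAux : (A ⊗[R] H) ⊗[R] boxDual R C →ₗ[R] A ⊗[R] boxDual R C →ₗ[R] A ⊗[R] boxDual R C :=
  TensorProduct.map₂ (LinearMap.mul R A)
    (TensorProduct.lift
      (S.twist.compr₂ (LinearMap.lcomp R (boxDual R C) (boxDual R C).subtype))) ∘ₗ
    (TensorProduct.assoc R A H (boxDual R C)).toLinearMap

/-- The product `(a # f)(b # g) = ∑ a₀ b # (a₁ g) ⋆ f`. -/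
def smashMul : A ⊗[R] boxDual R C →ₗ[R] A ⊗[R] boxDual R C →ₗ[R] A ⊗[R] boxDual R C :=
  S.smashAux ∘ₗ LinearMap.rTensor (boxDual R C) S.alg.coact.toLinearMap

variable {S}

lemma smashAux_tmul (x : A) (h : H) (f : boxDual R C) (b : A) (g : boxDual R C) :
    S.smashAux ((x ⊗ₜ h) ⊗ₜ f) (b ⊗ₜ g) = (x * b) ⊗ₜ S.twist h f g := rfl

lemma smashMul_tmul (a : A) (f : boxDual R C) (y : A ⊗[R] boxDual R C) :
    S.smashMul (a ⊗ₜ f) y = S.smashAux (S.alg.coact a ⊗ₜ f) y := rfl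

lemma smashMul_assoc (x y z : A ⊗[R] boxDual R C) :
    S.smashMul (S.smashMul x y) z = S.smashMul x (S.smashMul y z) := by
  induction x with
  | zero => simp
  | add x x' hx hx' => simp only [map_add, LinearMap.add_apply, hx, hx']
  | tmul a f =>
  induction y with
  | zero => simp
  | add x x' hx hx' => simp only [map_add, LinearMap.add_apply, hx, hx']
  | tmul b g =>
  induction z with
  | zero => simp
  | add x x' hx hx' => simp only [map_add, hx, hx']
  | tmul d k =>
  -- `r ⊗ s ↦ p ⊗ q ⊗ h ↦ p r d # ((q s k) ⋆ (h g)) ⋆ f`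
  let P : H →ₗ[R] boxDual R C := LinearMap.applyₗ (g : Dual R C) ∘ₗ S.twist.flip f
  let Ω : A ⊗[R] H →ₗ[R] A ⊗[R] (H ⊗[R] H) →ₗ[R] A ⊗[R] boxDual R C :=
    TensorProduct.map₂ ((LinearMap.mul R A).flip.compr₂ (LinearMap.mulRight R d))
      ((TensorProduct.lift (S.twist.compl₂ P)).flip ∘ₗ S.dualAct.flip k)
  have hΩ : ∀ r s p q h, Ω (r ⊗ₜ s) (p ⊗ₜ (q ⊗ₜ h)) =
      ((p * r) * d) ⊗ₜ mulBox (S.dualAct q (S.dualAct s k)) (mulBox (S.dualAct h g) f) :=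
    fun _ _ _ _ _ => rfl
  have e1 : ∀ t : A ⊗[R] H, S.smashMul (S.smashAux (t ⊗ₜ f) (b ⊗ₜ g)) (d ⊗ₜ k) =
      Ω (S.alg.coact b) (TensorProduct.assoc R A H H
        (LinearMap.rTensor H S.alg.coact.toLinearMap t)) := by
    intro t
    induction t with
    | zero => simp
    | add x y hx hy => simp only [TensorProduct.add_tmul, map_add, LinearMap.add_apply, hx, hy]
    | tmul a' h =>
      rw [smashAux_tmul, smashMul_tmul, map_mul]
      change _ = Ω (S.alg.coact b) (TensorProduct.assoc R A H H (S.alg.coact a' ⊗ₜ h))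
      generalize S.alg.coact b = v
      generalize S.alg.coact a' = u
      induction u with
      | zero => simp
      | add x y hx hy =>
        simp only [TensorProduct.add_tmul, map_add, LinearMap.add_apply, add_mul, hx, hy]
      | tmul p q =>
        induction v with
        | zero => simp
        | add x y hx hy =>
          simp only [TensorProduct.add_tmul, map_add, LinearMap.add_apply, mul_add, hx, hy]
        | tmul r s =>
          rw [Algebra.TensorProduct.tmul_mul_tmul, smashAux_tmul, TensorProduct.assoc_tmul, hΩ,
            ← dualAct_mul]
          rfl
  have e2 : ∀ v t : A ⊗[R] H, S.smashAux (t ⊗ₜ f) (S.smashAux (v ⊗ₜ g) (d ⊗ₜ k)) =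
      Ω v (LinearMap.lTensor A Coalgebra.comul t) := by
    intro v t
    induction v with
    | zero => simp
    | add x y hx hy => simp only [TensorProduct.add_tmul, map_add, LinearMap.add_apply, hx, hy]
    | tmul r s =>
      induction t with
      | zero => simp
      | add x y hx hy => simp only [TensorProduct.add_tmul, map_add, LinearMap.add_apply, hx, hy]
      | tmul p h =>
        rw [smashAux_tmul, smashAux_tmul, LinearMap.lTensor_tmul]
        have e3 : S.twist h f (S.twist s g k) = TensorProduct.lift (S.twist.compl₂ P)
            (Coalgebra.comul h) (S.dualAct s k) := by
          change mulBox (S.dualAct h (S.dualAct s k * g)) f = _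
          rw [dualAct_conv]
          generalize Coalgebra.comul (R := R) h = w
          induction w with
          | zero => simp
          | add x y hx hy => simp only [map_add, LinearMap.add_apply, hx, hy]
          | tmul q h' =>
            change mulBox (S.dualAct q (S.dualAct s k) * S.dualAct h' g) f = _
            rw [mulBox_mul]
            rfl
        rw [e3, ← mul_assoc]
        rfl
  rw [smashMul_tmul, e1, S.alg.coassoc, ← e2, smashMul_tmul, smashMul_tmul]

/-- The ring `A #ᵒᵖ C^□`, with product `(a # f)(b # g) = ∑ a₀ b # (a₁ g) ⋆ f`. -/
instance : NonUnitalRing S.OpSmash :=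
  { (inferInstance : AddCommGroup S.OpSmash) with
    mul := fun x y => S.smashMul x y
    left_distrib := fun x y z => map_add (S.smashMul x) y z
    right_distrib := fun x y z => LinearMap.map_add₂ S.smashMul x y z
    zero_mul := fun x => LinearMap.map_zero₂ S.smashMul x
    mul_zero := fun x => map_zero (S.smashMul x)
    mul_assoc := smashMul_assoc }

lemma OpSmash.mul_def (x y : S.OpSmash) : x * y = S.smashMul x y := rfl

variable (S)

/-- `a # f ↦ (b ⊗ c ↦ b a f(c))`, from `A #ᵒᵖ C^□` to `*𝒞`. -/
def smashToLeftDual : A ⊗[R] boxDual R C →ₗ[R] S.LeftDual :=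
  TensorProduct.lift (LinearMap.mk₂ R
    (fun (a : A) (f : boxDual R C) =>
      (show A ⊗[R] C →ₗ[A] A from TensorProduct.AlgebraTensorModule.lift
        (LinearMap.toSpanSingleton A (C →ₗ[R] A)
          (LinearMap.toSpanSingleton R A a ∘ₗ f.1.ofConv)) : S.LeftDual))
    (fun a a' f => LeftDual.ext fun c => by
      change 1 * (f.1 c • (a + a')) = 1 * (f.1 c • a) + 1 * (f.1 c • a')
      rw [smul_add, mul_add])
    (fun r a f => LeftDual.ext fun c => by
      change 1 * (f.1 c • r • a) = r • (1 * (f.1 c • a))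
      rw [one_mul, one_mul, smul_comm])
    (fun a f f' => LeftDual.ext fun c => by
      change 1 * ((f.1 c + f'.1 c) • a) = 1 * (f.1 c • a) + 1 * (f'.1 c • a)
      rw [add_smul, mul_add])
    (fun r a f => LeftDual.ext fun c => by
      change 1 * ((r • f.1 c) • a) = r • (1 * (f.1 c • a))
      rw [one_mul, one_mul, smul_assoc]))

variable {S}

lemma smashToLeftDual_tmul (a : A) (f : boxDual R C) (b : A) (c : C) :
    S.smashToLeftDual (a ⊗ₜ f) (b ⊗ₜ c) = b * (f.1 c • a) := rfl

lemma coringComul_one_tmul (c : C) : S.coringComul (1 ⊗ₜ c) =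
    TensorProduct.map (TensorProduct.mk R A C 1) (TensorProduct.mk R A C 1)
      (Coalgebra.comul c) := by
  rw [coringComul_tmul]
  generalize Coalgebra.comul (R := R) c = s
  induction s with
  | zero => simp
  | add x y hx hy => simp only [TensorProduct.tmul_add, map_add, hx, hy]
  | tmul x y => rfl

lemma smashToLeftDual_mul (x y : A ⊗[R] boxDual R C) :
    S.smashToLeftDual (S.smashMul x y) = S.smashToLeftDual x * S.smashToLeftDual y := by
  induction x with
  | zero => simp
  | add x x' hx hx' => simp only [map_add, LinearMap.add_apply, add_mul, hx, hx']
  | tmul a f =>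
  induction y with
  | zero => simp
  | add x x' hx hx' => simp only [map_add, mul_add, hx, hx']
  | tmul b g =>
  refine LeftDual.ext fun c => ?_
  rw [LeftDual.mul_apply, smashMul_tmul, coringComul_one_tmul]
  have e1 : ∀ s : C ⊗[R] C, contract (S.smashToLeftDual (a ⊗ₜ f)) (TensorProduct.map
      (TensorProduct.mk R A C 1) (TensorProduct.mk R A C 1) s) =
      S.coringAct (1 ⊗ₜ TensorProduct.rid R C (LinearMap.lTensor C f.1.ofConv s)) a := by
    intro s
    induction s with
    | zero => simp
    | add x y hx hy =>
      simp only [map_add, hx, hy, TensorProduct.tmul_add, LinearMap.add_apply]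
    | tmul x y =>
      simp [smashToLeftDual_tmul]
  have e2 : ∀ (q : H) (s : C ⊗[R] C),
      LinearMap.mul' R R (TensorProduct.map (S.dualAct q g.1).ofConv f.1.ofConv s) =
      g.1.ofConv (S.coalg.act (TensorProduct.rid R C (LinearMap.lTensor C f.1.ofConv s)) q) := by
    intro q s
    induction s with
    | zero => simp
    | add x y hx hy => simp only [map_add, hx, hy, LinearMap.add_apply]
    | tmul x y => simp [mul_comm, dualAct]
  rw [e1, coringAct_apply]
  generalize S.alg.coact a = t
  induction t with
  | zero => simp
  | add x y hx hy => simp only [TensorProduct.add_tmul, map_add, LinearMap.add_apply,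
      LeftDual.add_apply, hx, hy]
  | tmul p q =>
    rw [smashAux_tmul, TensorProduct.map₂_apply_tmul, smashToLeftDual_tmul,
      TensorProduct.map_tmul, LinearMap.mul_apply', smashToLeftDual_tmul, one_mul, one_mul, mul_smul_comm]
    congr 1
    exact e2 q _

end RightRight

/-! ### The canonical functors -/

namespace RRModule

variable {S : RightRight R H A C} (M : RRModule.{u₁, u₂, u₃, u₄, w} S)

/-- `n ⊗ c ↦ n f(1 ⊗ c)`. -/
def evalDual (f : S.LeftDual) : M.carrier ⊗[R] C →ₗ[R] M.carrier :=
  TensorProduct.lift (M.act.compl₂ (f.lin ∘ₗ TensorProduct.mk R A C 1))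

lemma evalDual_tmul (f : S.LeftDual) (n : M.carrier) (c : C) :
    M.evalDual f (n ⊗ₜ c) = M.act n (f (1 ⊗ₜ c)) := rfl

/-- The action `m f = ∑ m₀ f(1 ⊗ m₁)` of `*𝒞` on a Doi-Koppinen module. -/
def dualAction : M.carrier →ₗ[R] S.LeftDual →ₗ[R] M.carrier :=
  LinearMap.mk₂ R (fun m f => M.evalDual f (M.coact m))
    (fun m n f => by rw [map_add, map_add])
    (fun r m f => by rw [map_smul, map_smul])
    (fun m f g => by
      generalize M.coact m = x
      induction x with
      | zero => simp
      | add x y hx hy => simp only [map_add, hx, hy]; abel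
      | tmul n c => simp [evalDual_tmul])
    (fun r m f => by
      generalize M.coact m = x
      induction x with
      | zero => simp
      | add x y hx hy => simp only [map_add, hx, hy, smul_add]
      | tmul n c => simp [evalDual_tmul])

lemma dualAction_apply (m : M.carrier) (f : S.LeftDual) :
    M.dualAction m f = M.evalDual f (M.coact m) := rfl

lemma dualAction_mul (m : M.carrier) (f g : S.LeftDual) :
    M.dualAction m (f * g) = M.dualAction (M.dualAction m f) g := by
  simp only [dualAction_apply]
  -- `n ⊗ x ⊗ y ↦ n g((1 ⊗ x) f(1 ⊗ y))`
  let Θ : M.carrier ⊗[R] (C ⊗[R] C) →ₗ[R] M.carrier :=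
    TensorProduct.lift (M.act.compl₂ (g.lin ∘ₗ RightRight.contract f ∘ₗ
      TensorProduct.map (TensorProduct.mk R A C 1) (TensorProduct.mk R A C 1)))
  have e1 : ∀ x, M.evalDual (f * g) x = Θ (LinearMap.lTensor _ Coalgebra.comul x) := by
    intro x
    induction x with
    | zero => simp
    | add x y hx hy => simp only [map_add, hx, hy]
    | tmul n c =>
      rw [evalDual_tmul, RightRight.LeftDual.mul_apply, RightRight.coringComul_one_tmul]
      rfl
  have e3 : ∀ y t, M.evalDual g (TensorProduct.map₂ M.act S.coalg.act y t) =
      TensorProduct.lift (M.act.compl₂ (g.lin ∘ₗ (TensorProduct.map₂ (LinearMap.mul R A)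
        S.coalg.act).flip t ∘ₗ TensorProduct.mk R A C 1)) y := by
    intro y t
    induction y with
    | zero => simp
    | add x y hx hy => simp only [map_add, LinearMap.add_apply, hx, hy]
    | tmul n c =>
      induction t with
      | zero => simp
      | add x y hx hy =>
        rw [map_add, map_add, hx, hy]
        simp
      | tmul p q =>
        have hg : g ((p : A) ⊗ₜ[R] S.coalg.act c q) = p * g (1 ⊗ₜ S.coalg.act c q) := by
          rw [← g.map_smul_left, TensorProduct.smul_tmul', smul_eq_mul, mul_one]
        simp [evalDual_tmul, hg, M.act_mul]
  have e2 : ∀ x, M.evalDual g (M.coact (M.evalDual f x)) =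
      Θ (TensorProduct.assoc R _ _ _ (LinearMap.rTensor _ M.coact x)) := by
    intro x
    induction x with
    | zero => simp
    | add x y hx hy => simp only [map_add, hx, hy]
    | tmul n c =>
      rw [evalDual_tmul, M.compat, e3, LinearMap.rTensor_tmul]
      generalize M.coact n = z
      induction z with
      | zero => simp
      | add x y hx hy => simp only [TensorProduct.add_tmul, map_add, hx, hy]
      | tmul x y => rfl
  rw [e1, e2, M.coassoc]

end RRModule

variable (S : RightRight R H A C)

lemma RRModule.Hom.map_dualAction {S : RightRight R H A C}
    {M N : RRModule.{u₁, u₂, u₃, u₄, w} S} (φ : M.Hom N) (m : M.carrier) (f : S.LeftDual) :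
    φ.toLin (M.dualAction m f) = N.dualAction (φ.toLin m) f := by
  rw [RRModule.dualAction_apply, RRModule.dualAction_apply, φ.map_coact]
  generalize M.coact m = x
  induction x with
  | zero => simp
  | add x y hx hy => simp only [map_add, hx, hy]
  | tmul n c => simp [RRModule.evalDual_tmul, φ.map_act]

/-- The functor from `M(H)_A^C` to right `A #ᵒᵖ C^□`-modules, with
`m (a # f) = ∑ f(m₁) m₀ a`; it does not change underlying modules and maps. -/
def toOpSmash : RRModule.{u₁, u₂, u₃, u₄, w} S ⥤ RMod.{u₁, max u₁ u₃ u₄, w} R S.OpSmash where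
  obj M :=
    { carrier := M.carrier
      act := M.dualAction.compl₂ S.smashToLeftDual
      act_mul := fun m s t =>
        (congrArg (M.dualAction m) (RightRight.smashToLeftDual_mul (S := S) s t)).trans
          (M.dualAction_mul m _ _) }
  map φ := ⟨φ.toLin, fun m _ => φ.map_dualAction m _⟩

/-- The functor from `M(H)_A^C` to right `^□𝒞`-modules, with `m f = ∑ m₀ f(1 ⊗ m₁)`; it does not
change underlying modules and maps. -/
def toBoxDual : RRModule.{u₁, u₂, u₃, u₄, w} S ⥤ RMod.{u₁, max u₃ u₄, w} R S.boxLeftDual where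
  obj M :=
    { carrier := M.carrier
      act := M.dualAction.compl₂ S.boxLeftDual.toSubmodule.subtype
      act_mul := fun m s t => M.dualAction_mul m s.1 t.1 }
  map φ := ⟨φ.toLin, fun m _ => φ.map_dualAction m _⟩

end Coring

/-! ### The left-right case -/

section LeftRightCase

variable {R : Type u₁} {H : Type u₂} {A : Type u₃} {C : Type u₄} [CommRing R]
  [Ring H] [Bialgebra R H] [Ring A] [Algebra R A] [AddCommGroup C] [Module R C] [Coalgebra R C]
  (S : LeftRight R H A C)

/-- The smash product `A # C^□ := (Aᵒᵖ #ᵒᵖ C^□)ᵒᵖ` of a left-right Doi-Koppinen structure. Its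
product is `(a # f)(b # g) = ∑ a b₀ # (f b₁) ⋆ g`, where `(f h)(c) = f(h c)`. -/
abbrev LeftRight.Smash : Type (max u₁ u₃ u₄) := (S.op.OpSmash)ᵐᵒᵖ

/-- The functor from `_A M(H)^C` to left `A # C^□`-modules, with
`(a # f) m = ∑ f(m₁) a m₀`. -/
def toSmash : LRModule.{u₁, u₂, u₃, u₄, w} S ⥤ LMod.{u₁, max u₁ u₃ u₄, w} R S.Smash :=
  LRModule.opFunctor S ⋙ toOpSmash S.op ⋙ RMod.opFunctor R S.op.OpSmash

/-- The functor from `_A M(H)^C` to left `(^□𝒟)ᵒᵖ`-modules, where `𝒟 = Aᵒᵖ ⊗ C` is the coring of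
`(Hᵒᵖ, Aᵒᵖ, C)`, with `f m = ∑ f(1 ⊗ m₁) m₀`. -/
def toBoxDualOp :
    LRModule.{u₁, u₂, u₃, u₄, w} S ⥤ LMod.{u₁, max u₃ u₄, w} R (S.op.boxLeftDual)ᵐᵒᵖ :=
  LRModule.opFunctor S ⋙ toBoxDual S.op ⋙ RMod.opFunctor R S.op.boxLeftDual

end LeftRightCase

end

end DoiKoppinen

/-! Local projectivity and left coproperness together give, for each finite subset of `C`, a finite
dual basis with functionals in `C^□` (`exists_dual_basis`). Hence a tensor in `M ⊗ C` can be rebuilt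
from its values under `id ⊗ f`, `f ∈ C^□` (`exists_sum_evalRight`, `evalRight_separates`), for any
`R`-module `M`. So a coaction is the same as the operators `m ↦ ∑ f(m₁) m₀` it induces, and
identities between coactions may be tested on `C^□`.

For a unital `A #ᵒᵖ C^□`-module `N` one looks for a tensor `∑ n₀ a ⊗ n₁` whose value at each `f` is
`n (a # f)`. If `n = n' (b # g)`, that value is `n' (∑ b₀ a # (b₁ f) ⋆ g)`. Since `g` is rational,
this expression is evaluation of `f` on one fixed tensor (`exists_smashDual_eq`), and it still makes
sense for every `f ∈ C*`. Unitality extends existence to all `n`; separation gives uniqueness and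
linearity. Taking `a = 1` gives the coaction, and evaluating at the counit of `C` gives the
`A`-action. The Doi-Koppinen axioms become identities in `A ⊗ C^□`.

For `^□𝒞`, the map `A #ᵒᵖ C^□ → *𝒞` lands in `^□𝒞` (`smashToLeftDual_mem`), and its image agrees
with any given element of `*𝒞` at any finitely many `1 ⊗ c`. For `f ∈ ^□𝒞` the product `f ⋆ g`
depends on only finitely many such values of `g`, so `g` may be replaced by an element of the image
(`exists_mul_eq_mul_smashToLeftDual`). Unital `^□𝒞`-modules therefore restrict to unital `A #ᵒᵖ
C^□`-modules, and the restriction determines the full action.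

The left-right case follows by composing with the isomorphisms that pass to opposite structures. -/

namespace DoiKoppinen

open TensorProduct CategoryTheory

/-! ### Functors that are isomorphisms onto a full subcategory -/

section IsoOnto

variable {𝒳 𝒴 𝒵 : Type*} [Category 𝒳] [Category 𝒴] [Category 𝒵]

/-- `F` is fully faithful, injective on objects, and its image consists of the objects
satisfying `P`. -/
structure IsIsoOnto (F : 𝒳 ⥤ 𝒴) (P : ObjectProperty 𝒴) : Prop where
  full : F.Full
  faithful : F.Faithful
  injective : Function.Injective F.obj
  mem_iff : ∀ Y, P Y ↔ ∃ X, F.obj X = Y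

/-- The inverse sends a morphism to its `F`-preimage after conjugation by `eqToHom`. Since the
required functor equalities are strict, bijectivity on objects is needed, and not just essential
surjectivity. -/
lemma isIsoOfCategories_of_bijective (F : 𝒳 ⥤ 𝒴) [F.Full] [F.Faithful]
    (hF : Function.Bijective F.obj) : IsIsoOfCategories F := by
  choose g hg using hF.2
  let G : 𝒴 ⥤ 𝒳 :=
    { obj := g
      map := fun {X Y} f => F.preimage (eqToHom (hg X) ≫ f ≫ eqToHom (hg Y).symm)
      map_id := fun X => F.map_injective (by simp)
      map_comp := fun f f' => F.map_injective (by simp) }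
  refine ⟨G, ?_, ?_⟩
  · refine CategoryTheory.Functor.ext (fun X => hF.1 (hg _)) fun X Y f => F.map_injective ?_
    simp [G, eqToHom_map]
  · refine CategoryTheory.Functor.ext hg fun X Y f => ?_
    simp [G]

lemma IsIsoOnto.exists_lift {F : 𝒳 ⥤ 𝒴} {P : ObjectProperty 𝒴} (hF : IsIsoOnto F P) :
    ∃ h : ∀ X, P (F.obj X), IsIsoOfCategories (P.lift F h) := by
  have := hF.full
  have := hF.faithful
  refine ⟨fun X => (hF.mem_iff _).2 ⟨X, rfl⟩, isIsoOfCategories_of_bijective _ ⟨?_, ?_⟩⟩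
  · intro X Y h
    exact hF.injective (congrArg ObjectProperty.FullSubcategory.obj h)
  · rintro ⟨Y, hY⟩
    obtain ⟨X, rfl⟩ := (hF.mem_iff Y).1 hY
    exact ⟨X, rfl⟩

lemma IsIsoOnto.comp {F : 𝒳 ⥤ 𝒴} {G : 𝒴 ⥤ 𝒵} {P : ObjectProperty 𝒴} {Q : ObjectProperty 𝒵}
    (hF : IsIsoOnto F P) (hG : IsIsoOnto G ⊤) (hPQ : ∀ Y, Q (G.obj Y) ↔ P Y) :
    IsIsoOnto (F ⋙ G) Q where
  full := have := hF.full; have := hG.full; inferInstance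
  faithful := have := hF.faithful; have := hG.faithful; inferInstance
  injective := hG.injective.comp hF.injective
  mem_iff Z := by
    constructor
    · intro hZ
      obtain ⟨Y, rfl⟩ := (hG.mem_iff Z).1 trivial
      obtain ⟨X, rfl⟩ := (hF.mem_iff Y).1 ((hPQ Y).1 hZ)
      exact ⟨X, rfl⟩
    · rintro ⟨X, rfl⟩
      exact (hPQ _).2 ((hF.mem_iff _).2 ⟨X, rfl⟩)

lemma IsIsoOnto.precomp {F : 𝒳 ⥤ 𝒴} {G : 𝒴 ⥤ 𝒵} {Q : ObjectProperty 𝒵}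
    (hF : IsIsoOnto F ⊤) (hG : IsIsoOnto G Q) : IsIsoOnto (F ⋙ G) Q where
  full := have := hF.full; have := hG.full; inferInstance
  faithful := have := hF.faithful; have := hG.faithful; inferInstance
  injective := hG.injective.comp hF.injective
  mem_iff Z := by
    rw [hG.mem_iff]
    constructor
    · rintro ⟨Y, rfl⟩
      obtain ⟨X, rfl⟩ := (hF.mem_iff Y).1 trivial
      exact ⟨X, rfl⟩
    · rintro ⟨X, rfl⟩
      exact ⟨_, rfl⟩

end IsoOnto

/-! ### Evaluation of the coalgebra leg of a tensor -/

noncomputable section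

section Eval

variable {R : Type u₁} {C : Type u₄} [CommRing R] [AddCommGroup C] [Module R C]
  {M N : Type*} [AddCommMonoid M] [Module R M] [AddCommMonoid N] [Module R N]

/-- `m ⊗ c ↦ f(c) m`. -/
def evalRight (f : Dual R C) : M ⊗[R] C →ₗ[R] M :=
  (TensorProduct.rid R M).toLinearMap ∘ₗ LinearMap.lTensor M f.ofConv

@[simp] lemma evalRight_tmul (f : Dual R C) (m : M) (c : C) : evalRight f (m ⊗ₜ[R] c) = f c • m :=
  rfl

lemma Dual.map_add (f : Dual R C) (x y : C) : f (x + y) = f x + f y := f.ofConv.map_add x y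

lemma Dual.map_smul (f : Dual R C) (r : R) (x : C) : f (r • x) = r * f x := f.ofConv.map_smul r x

lemma evalRight_rTensor (f : Dual R C) (φ : M →ₗ[R] N) (t : M ⊗[R] C) :
    evalRight f (LinearMap.rTensor C φ t) = φ (evalRight f t) := by
  induction t with
  | zero => simp
  | add x y hx hy => simp only [map_add, hx, hy]
  | tmul m c => simp

/-- Lift the identity of `C` on the span of `F` through the free cover `C →₀ R → C`. -/
lemma IsLocallyProjective.exists_linearCombination (hC : IsLocallyProjective R C) (F : Finset C) :
    ∃ h : C →ₗ[R] (C →₀ R), ∀ c ∈ F, Finsupp.linearCombination R id (h c) = c := by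
  -- `IsLocallyProjective` quantifies over modules in `Type (max u₁ u₄)`, hence the `ULift` of `C`.
  obtain ⟨h, hh⟩ := hC (Submodule.span R F) ⟨F, rfl⟩ (C →₀ R) (ULift.{u₁} C)
    (ULift.moduleEquiv.symm.toLinearMap ∘ₗ Finsupp.linearCombination R id)
    (ULift.moduleEquiv.symm.surjective.comp (fun c => ⟨Finsupp.single c 1, by simp⟩))
    ULift.moduleEquiv.symm.toLinearMap
  exact ⟨h, fun c hc => ULift.moduleEquiv.symm.injective (hh c (Submodule.subset_span hc))⟩

variable [Coalgebra R C]

/-- After reassociation `g` sees the second leg of the comultiplication and `f` the first; this is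
the order in the convolution product. Coassociativity is tested through this formula. -/
lemma evalRight_comul (f g : Dual R C) (t : M ⊗[R] C) :
    evalRight f (evalRight g ((TensorProduct.assoc R M C C).symm
      (LinearMap.lTensor M Coalgebra.comul t))) = evalRight (f * g) t := by
  induction t with
  | zero => simp
  | add x y hx hy => simp only [map_add, hx, hy]
  | tmul m c =>
    change evalRight f (evalRight g ((TensorProduct.assoc R M C C).symm
      (m ⊗ₜ Coalgebra.comul c))) =
      (LinearMap.mul' R R (TensorProduct.map f.ofConv g.ofConv (Coalgebra.comul c))) • m
    generalize Coalgebra.comul (R := R) c = y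
    induction y with
    | zero => simp
    | add x y hx hy => simp only [tmul_add, map_add, hx, hy, add_smul]
    | tmul u v => simp [mul_smul, smul_comm (f u)]

lemma dual_mul_apply (f g : Dual R C) (c : C) :
    (f * g) c = f (evalRight g (Coalgebra.comul c)) := by
  change LinearMap.mul' R R (TensorProduct.map f.ofConv g.ofConv (Coalgebra.comul c)) =
    f.ofConv (evalRight g (Coalgebra.comul c))
  generalize Coalgebra.comul (R := R) c = y
  induction y with
  | zero => simp
  | add x y hx hy => simp only [map_add, hx, hy]
  | tmul u v => simp [mul_comm]

lemma dualEval_eq_evalRight (f : Dual R C) (t : Dual R C ⊗[R] C) : dualEval f t = evalRight f t := by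
  induction t with
  | zero => simp
  | add x y hx hy => simp only [map_add, hx, hy]
  | tmul m c => rfl

/-- A locally projective, left coproper coalgebra has finite dual bases in `C^□`. -/
lemma exists_dual_basis (hC : IsLocallyProjective R C) (hcop : IsLeftCoproper R C)
    (F : Finset C) : ∃ (E : Finset C) (f : C → boxDual R C),
      ∀ c ∈ F, ∑ e ∈ E, (f e).1 c • e = c := by
  classical
  obtain ⟨h, hh⟩ := hC.exists_linearCombination F
  have key : ∀ e : C, ∃ g : boxDual R C, ∀ c ∈ F, g.1 c = h c e := by
    intro e
    -- The coordinate functionals of the lift lie only in `C*`; density replaces each by an element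
    -- of `C^□` with the same values on `F`.
    obtain ⟨g, hg, hgF⟩ := hcop (WithConv.toConv (Finsupp.lapply e ∘ₗ h)) F
    exact ⟨⟨g, hg⟩, hgF⟩
  choose f hf using key
  refine ⟨F.biUnion fun c => (h c).support, f, fun c hc => ?_⟩
  conv_rhs => rw [← hh c hc]
  rw [Finsupp.linearCombination_apply, Finsupp.sum_of_support_subset (h c)
    (Finset.subset_biUnion_of_mem (fun c => (h c).support) hc) _ (by simp)]
  exact Finset.sum_congr rfl fun e _ => by rw [hf e c hc]; rfl

variable (hC : IsLocallyProjective R C) (hcop : IsLeftCoproper R C)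
include hC hcop

/-- Expand the finitely many `C`-legs of `t` in a dual basis and move the scalars to the `M`-side.
-/
lemma exists_sum_evalRight (t : M ⊗[R] C) : ∃ (E : Finset C) (f : C → boxDual R C),
    ∑ e ∈ E, evalRight (f e).1 t ⊗ₜ[R] e = t := by
  classical
  obtain ⟨P, hP⟩ := TensorProduct.exists_finset t
  obtain ⟨E, f, hf⟩ := exists_dual_basis hC hcop (P.image Prod.snd)
  refine ⟨E, f, ?_⟩
  rw [hP]
  simp only [_root_.map_sum, evalRight_tmul, TensorProduct.sum_tmul]
  rw [Finset.sum_comm]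
  refine Finset.sum_congr rfl fun p hp => ?_
  conv_rhs => rw [← hf p.2 (Finset.mem_image_of_mem _ hp)]
  simp only [TensorProduct.tmul_sum, TensorProduct.smul_tmul]

lemma evalRight_separates {M : Type*} [AddCommGroup M] [Module R M] {s t : M ⊗[R] C}
    (h : ∀ f : boxDual R C, evalRight f.1 s = evalRight f.1 t) : s = t := by
  -- The dual basis depends on the tensor, so it is chosen for the difference.
  obtain ⟨E, f, hf⟩ := exists_sum_evalRight hC hcop (s - t)
  rw [← sub_eq_zero, ← hf]
  exact Finset.sum_eq_zero fun e _ => by rw [map_sub, h, sub_self, TensorProduct.zero_tmul]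

lemma boxDual_separates {c d : C} (h : ∀ f : boxDual R C, f.1 c = f.1 d) : c = d := by
  classical
  obtain ⟨E, f, hf⟩ := exists_dual_basis hC hcop {c, d}
  rw [← hf c (by simp), ← hf d (by simp)]
  simp only [h]

omit hC in
-- Only the finitely many `C`-legs of `t` matter. With `g` the counit, this is the source of
-- unitality.
lemma exists_evalRight_eq (g : Dual R C) (t : M ⊗[R] C) :
    ∃ f : boxDual R C, evalRight f.1 t = evalRight g t := by
  classical
  obtain ⟨P, hP⟩ := TensorProduct.exists_finset t
  obtain ⟨f, hf, hfP⟩ := hcop g (P.image Prod.snd)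
  refine ⟨⟨f, hf⟩, ?_⟩
  rw [hP]
  simp only [_root_.map_sum, evalRight_tmul]
  exact Finset.sum_congr rfl fun p hp => by rw [hfP _ (Finset.mem_image_of_mem _ hp)]

/-- `C^□` is a right `C`-comodule. -/
lemma exists_mulBox_eq (g : boxDual R C) :
    ∃ t : boxDual R C ⊗[R] C, ∀ h : Dual R C, mulBox h g = evalRight h t := by
  obtain ⟨t, ht⟩ := g.2
  obtain ⟨E, f, hf⟩ := exists_sum_evalRight hC hcop t
  -- The given `t` has left legs in `C*` only. Its expansion in a dual basis has left legs `f_e ⋆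
  -- g`, which lie in the left ideal `C^□`.
  refine ⟨∑ e ∈ E, mulBox (f e).1 g ⊗ₜ e, fun h => Subtype.ext ?_⟩
  rw [coe_mulBox, ht, dualEval_eq_evalRight, ← hf, ← (boxDual R C).subtype_apply]
  simp only [_root_.map_sum, evalRight_tmul, _root_.map_smul]
  exact Finset.sum_congr rfl fun e _ => by
    rw [Submodule.subtype_apply, coe_mulBox, ht, dualEval_eq_evalRight]

end Eval

/-! ### The product of `A #ᵒᵖ C^□` extended to arbitrary functionals in `C*` -/

section RightRightCase

variable {R : Type u₁} {H : Type u₂} {A : Type u₃} {C : Type u₄} [CommRing R]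
  [Ring H] [Bialgebra R H] [Ring A] [Algebra R A] [AddCommGroup C] [Module R C] [Coalgebra R C]

namespace RightRight

variable (S : RightRight R H A C)

/-- The extension `(b # g)(a # h) = ∑ b₀ a # (b₁ h) ⋆ g` of the product of `A #ᵒᵖ C^□` to all
`h ∈ C*`. -/
def smashDual : A ⊗[R] boxDual R C →ₗ[R] A ⊗[R] Dual R C →ₗ[R] A ⊗[R] boxDual R C :=
  TensorProduct.map₂ (LinearMap.mul R A) (TensorProduct.lift S.twist) ∘ₗ
    (TensorProduct.assoc R A H (boxDual R C)).toLinearMap ∘ₗ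
      LinearMap.rTensor (boxDual R C) S.alg.coact.toLinearMap

/-- `b # g ↦ b a # g`. -/
def smashRight (_ : RightRight R H A C) (a : A) :
    A ⊗[R] boxDual R C →ₗ[R] A ⊗[R] boxDual R C :=
  LinearMap.rTensor _ (LinearMap.mulRight R a)

variable {S}

@[simp] lemma smashRight_tmul (a b : A) (g : boxDual R C) :
    S.smashRight a (b ⊗ₜ g) = (b * a) ⊗ₜ g := rfl

lemma smashRight_one (s : A ⊗[R] boxDual R C) : S.smashRight 1 s = s := by
  induction s with
  | zero => simp
  | add x y hx hy => simp only [map_add, hx, hy]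
  | tmul b g => simp

lemma smashRight_mul (a b : A) (s : A ⊗[R] boxDual R C) :
    S.smashRight (a * b) s = S.smashRight b (S.smashRight a s) := by
  induction s with
  | zero => simp
  | add x y hx hy => simp only [map_add, hx, hy]
  | tmul b g => simp [mul_assoc]

lemma smashDual_tmul (b : A) (g : boxDual R C) (x : A ⊗[R] Dual R C) :
    S.smashDual (b ⊗ₜ g) x = TensorProduct.map₂ (LinearMap.mul R A) (TensorProduct.lift S.twist)
      (TensorProduct.assoc R A H (boxDual R C) (S.alg.coact b ⊗ₜ g)) x := rfl

lemma twist_apply (h : H) (f : boxDual R C) (g : Dual R C) :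
    S.twist h f g = mulBox (S.dualAct h g) f := rfl

lemma smashMul_eq_smashDual (s : A ⊗[R] boxDual R C) (a : A) (f : boxDual R C) :
    S.smashMul s (a ⊗ₜ f) = S.smashDual s (a ⊗ₜ f.1) := by
  induction s with
  | zero => simp
  | add x y hx hy => simp only [map_add, LinearMap.add_apply, hx, hy]
  | tmul b g =>
    rw [smashMul_tmul, smashDual_tmul]
    generalize S.alg.coact b = y
    induction y with
    | zero => simp
    | add x y hx hy => simp only [add_tmul, map_add, LinearMap.add_apply, hx, hy]
    | tmul p q => rfl

/-- The order of the factors is reversed; this matches coassociativity, where evaluating at `f` and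
then acting by `g` amounts to `g ⋆ f`. -/
lemma smashMul_one_tmul (f g : boxDual R C) :
    S.smashMul (1 ⊗ₜ f) (1 ⊗ₜ g) = 1 ⊗ₜ mulBox g.1 f := by
  have h : S.dualAct 1 g.1 = g.1 := by
    ext c
    exact congrArg g.1.ofConv (S.coalg.act_one c)
  rw [smashMul_eq_smashDual, smashDual_tmul, map_one, Algebra.TensorProduct.one_def,
    TensorProduct.assoc_tmul]
  change ((1 : A) * 1) ⊗ₜ mulBox (S.dualAct 1 g.1) f = _
  rw [h, one_mul]

lemma smashRight_smashDual (s : A ⊗[R] boxDual R C) (a : A) (h : Dual R C) :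
    S.smashRight a (S.smashDual s (1 ⊗ₜ h)) = S.smashDual s (a ⊗ₜ h) := by
  induction s with
  | zero => simp
  | add x y hx hy => simp only [map_add, LinearMap.add_apply, hx, hy]
  | tmul b g =>
    rw [smashDual_tmul, smashDual_tmul]
    generalize S.alg.coact b = y
    induction y with
    | zero => simp
    | add x y hx hy => simp only [add_tmul, map_add, LinearMap.add_apply, hx, hy]
    | tmul p q => simp

lemma dualAct_one_right (h : H) :
    S.dualAct h (1 : Dual R C) = Coalgebra.counit (R := R) h • (1 : Dual R C) := by
  ext c
  change Coalgebra.counit (R := R) (S.coalg.act c h) =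
    Coalgebra.counit (R := R) h * Coalgebra.counit (R := R) c
  rw [S.coalg.counit_act, mul_comm]

/-- The counit of `C` need not lie in `C^□`, but it can stand in the right factor of the extended
product. There `h` acts on it by `ε(h)`, so the counit axiom of `A` collapses the sum. The
`A`-action on a unital module is recovered from this. -/
lemma smashDual_one (s : A ⊗[R] boxDual R C) (a : A) :
    S.smashDual s (a ⊗ₜ 1) = S.smashRight a s := by
  induction s with
  | zero => simp
  | add x y hx hy => simp only [map_add, LinearMap.add_apply, hx, hy]
  | tmul b g =>
    have e : ∀ y : A ⊗[R] H, TensorProduct.map₂ (LinearMap.mul R A) (TensorProduct.lift S.twist)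
        (TensorProduct.assoc R A H (boxDual R C) (y ⊗ₜ g)) (a ⊗ₜ 1) =
        S.smashRight a (TensorProduct.rid R A (LinearMap.lTensor A Coalgebra.counit y) ⊗ₜ g) := by
      intro y
      induction y with
      | zero => simp
      | add x y hx hy => simp only [add_tmul, map_add, LinearMap.add_apply, hx, hy]
      | tmul p q =>
        have h1 : mulBox (1 : Dual R C) g = g := Subtype.ext (one_mul g.1)
        simp [twist_apply, dualAct_one_right, h1, TensorProduct.smul_tmul]
    rw [smashDual_tmul, e, S.alg.counit]
    simp

/-- Multiplicativity of the coaction of `A`, in the form that yields the compatibility `ϱ(n a) = ∑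
n₀ a₀ ⊗ n₁ a₁`. -/
lemma smashDual_smashRight (s : A ⊗[R] boxDual R C) (a : A) (f : Dual R C) :
    S.smashDual (S.smashRight a s) (1 ⊗ₜ f) =
      S.smashDual s (LinearMap.lTensor A (S.dualAct.flip f) (S.alg.coact a)) := by
  induction s with
  | zero => simp
  | add x y hx hy => simp only [map_add, LinearMap.add_apply, hx, hy]
  | tmul b g =>
    rw [smashRight_tmul, smashDual_tmul, smashDual_tmul, map_mul]
    generalize S.alg.coact b = y
    generalize S.alg.coact a = z
    induction y with
    | zero => simp
    | add x y hx hy => simp only [add_mul, add_tmul, map_add, LinearMap.add_apply, hx, hy]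
    | tmul p q =>
      induction z with
      | zero => simp
      | add x y hx hy => simp only [mul_add, add_tmul, map_add, LinearMap.add_apply, hx, hy]
      | tmul p' q' => simp [twist_apply, dualAct_mul]

lemma evalRight_map {M N : Type*} [AddCommMonoid M] [Module R M] [AddCommMonoid N] [Module R N]
    (f : Dual R C) (φ : M →ₗ[R] N) (h : H) (t : M ⊗[R] C) :
    evalRight f (TensorProduct.map φ (S.coalg.act.flip h) t) = φ (evalRight (S.dualAct h f) t) := by
  induction t with
  | zero => simp
  | add x y hx hy => simp only [map_add, hx, hy]
  | tmul m c => simp [dualAct_apply]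

/-- Rationality of left multiplication by `s`. For `s = b # g` and `h ⋆ g = ∑ h(cᵢ) gᵢ`, the tensor
is `∑ (b₀ a # gᵢ) ⊗ cᵢ b₁`. It serves all `h ∈ C*`, in particular the counit. -/
lemma exists_smashDual_eq (hC : IsLocallyProjective R C) (hcop : IsLeftCoproper R C)
    (s : A ⊗[R] boxDual R C) (a : A) : ∃ t : (A ⊗[R] boxDual R C) ⊗[R] C,
      ∀ h : Dual R C, evalRight h t = S.smashDual s (a ⊗ₜ h) := by
  induction s with
  | zero => exact ⟨0, by simp⟩
  | add x y hx hy =>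
    obtain ⟨t, ht⟩ := hx
    obtain ⟨u, hu⟩ := hy
    exact ⟨t + u, fun h => by simp only [map_add, LinearMap.add_apply, ht, hu]⟩
  | tmul b g =>
    simp only [smashDual_tmul]
    generalize S.alg.coact b = y
    induction y with
    | zero => exact ⟨0, by simp⟩
    | add x y hx hy =>
      obtain ⟨t, ht⟩ := hx
      obtain ⟨u, hu⟩ := hy
      exact ⟨t + u, fun h => by simp only [add_tmul, map_add, LinearMap.add_apply, ht, hu]⟩
    | tmul p q =>
      obtain ⟨t, ht⟩ := exists_mulBox_eq hC hcop g
      refine ⟨TensorProduct.map (TensorProduct.mk R A _ (p * a)) (S.coalg.act.flip q) t,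
        fun h => ?_⟩
      have h1 := evalRight_map (S := S) h (TensorProduct.mk R A (boxDual R C) (p * a)) q t
      rw [← ht] at h1
      exact h1

end RightRight

/-! ### Doi-Koppinen modules as `A #ᵒᵖ C^□`-modules -/

variable {S : RightRight R H A C}

lemma RRModule.map_evalRight_act {M : Type*} [AddCommMonoid M] [Module R M]
    (α : M →ₗ[R] A →ₗ[R] M) (f : Dual R C) (x : M ⊗[R] C) (p : A) (q : H) :
    evalRight f (TensorProduct.map₂ α S.coalg.act x (p ⊗ₜ q)) =
      α (evalRight (S.dualAct q f) x) p := by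
  induction x with
  | zero => simp
  | add x y hx hy => simp only [map_add, LinearMap.add_apply, hx, hy]
  | tmul m c => simp [RightRight.dualAct_apply]

lemma RRModule.evalRight_counit (M : RRModule.{u₁, u₂, u₃, u₄, w} S) (m : M.carrier) :
    evalRight (1 : Dual R C) (M.coact m) = m := by
  have h := congrArg (TensorProduct.rid R M.carrier) (M.counit m)
  rw [TensorProduct.rid_tmul, one_smul] at h
  exact h

/-- The action of `A #ᵒᵖ C^□`, as a bilinear map on `A ⊗ C^□`. -/
def RMod.smashAct (N : RMod.{u₁, max u₁ u₃ u₄, w} R S.OpSmash) :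
    N.carrier →ₗ[R] A ⊗[R] boxDual R C →ₗ[R] N.carrier := N.act

lemma toOpSmash_smashAct (M : RRModule.{u₁, u₂, u₃, u₄, w} S) (m : M.carrier) (a : A)
    (f : boxDual R C) :
    RMod.smashAct ((toOpSmash S).obj M) m (a ⊗ₜ f) =
      M.act (evalRight f.1 (M.coact m)) a := by
  change M.evalDual (S.smashToLeftDual (a ⊗ₜ f)) (M.coact m) = _
  generalize M.coact m = x
  induction x with
  | zero => simp
  | add x y hx hy => simp only [map_add, LinearMap.add_apply, hx, hy]
  | tmul n c => simp [RRModule.evalDual_tmul, RightRight.smashToLeftDual_tmul]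

/-- Each `m` equals `m (1 # f)` for an `f ∈ C^□` that agrees with the counit on the `C`-legs of
`ϱ(m)`. -/
lemma toOpSmash_isUnital (hcop : IsLeftCoproper R C) (M : RRModule.{u₁, u₂, u₃, u₄, w} S) :
    RMod.IsUnital R S.OpSmash ((toOpSmash S).obj M) := by
  refine Submodule.eq_top_iff'.2 fun m => Submodule.subset_span ?_
  obtain ⟨f, hf⟩ := exists_evalRight_eq hcop 1 (M.coact m)
  refine ⟨m, (1 ⊗ₜ f : A ⊗[R] boxDual R C), (toOpSmash_smashAct M m 1 f).trans ?_⟩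
  exact (congrArg (M.act · 1) (hf.trans (M.evalRight_counit m))).trans (M.act_one m)

instance toOpSmash_faithful : (toOpSmash.{u₁, u₂, u₃, u₄, w} S).Faithful where
  map_injective h := RRModule.Hom.ext (congrArg RMod.Hom.toLin h)

lemma toOpSmash_full (hC : IsLocallyProjective R C) (hcop : IsLeftCoproper R C) :
    (toOpSmash.{u₁, u₂, u₃, u₄, w} S).Full where
  map_surjective {M N} φ := by
    let φ' : M.carrier →ₗ[R] N.carrier := RMod.Hom.toLin φ
    -- Linearity over `A #ᵒᵖ C^□` is `∑ φ(m)₀ a ⊗ φ(m)₁ = ∑ φ(m₀ a) ⊗ m₁` tested on `C^□`. Applying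
    -- the counit gives `A`-linearity, and `a = 1` gives colinearity.
    have key : ∀ m a, LinearMap.rTensor C (N.act.flip a) (N.coact (φ' m)) =
        LinearMap.rTensor C (φ' ∘ₗ M.act.flip a) (M.coact m) := by
      intro m a
      refine evalRight_separates hC hcop fun f => ?_
      rw [evalRight_rTensor, evalRight_rTensor]
      have h := RMod.Hom.map_act φ m (a ⊗ₜ f : A ⊗[R] boxDual R C)
      exact (toOpSmash_smashAct N (φ' m) a f).symm.trans
        (h.symm.trans (congrArg φ' (toOpSmash_smashAct M m a f)))
    refine ⟨⟨φ', fun m a => ?_, fun m => ?_⟩, rfl⟩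
    · have h := congrArg (evalRight (1 : Dual R C)) (key m a)
      rw [evalRight_rTensor, evalRight_rTensor, M.evalRight_counit, N.evalRight_counit] at h
      exact h.symm
    · have hM : M.act.flip 1 = LinearMap.id := LinearMap.ext M.act_one
      have hN : N.act.flip 1 = LinearMap.id := LinearMap.ext N.act_one
      have h := key m 1
      rw [hM, hN, LinearMap.rTensor_id, LinearMap.comp_id] at h
      exact h

end RightRightCase

/-! ### Reconstruction of the Doi-Koppinen structure on a unital `A #ᵒᵖ C^□`-module -/

section Reconstruction

variable {R : Type u₁} {H : Type u₂} {A : Type u₃} {C : Type u₄} [CommRing R]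
  [Ring H] [Bialgebra R H] [Ring A] [Algebra R A] [AddCommGroup C] [Module R C] [Coalgebra R C]
  {S : RightRight R H A C}

namespace RMod

variable {N : RMod.{u₁, max u₁ u₃ u₄, w} R S.OpSmash}

lemma smashAct_mul (n : N.carrier) (s t : A ⊗[R] boxDual R C) :
    N.smashAct n (S.smashMul s t) = N.smashAct (N.smashAct n s) t := N.act_mul n s t

lemma IsUnital.induction (hN : RMod.IsUnital R S.OpSmash N) {P : N.carrier → Prop}
    (hact : ∀ n s, P (N.smashAct n s)) (hadd : ∀ m n, P m → P n → P (m + n)) (n : N.carrier) :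
    P n := by
  -- Proving `P` for all multiples frees it from a closure assumption under scalars: `r (m t) = (r
  -- m) t` is again a product.
  suffices h : ∀ r : R, P (r • n) by simpa using h 1
  have hn : n ∈ Submodule.span R {x | ∃ m t, N.act m t = x} := by rw [hN]; trivial
  induction hn using Submodule.span_induction with
  | mem x hx =>
    obtain ⟨m, t, rfl⟩ := hx
    intro r
    have h := hact (r • m) t
    rwa [map_smul] at h
  | zero => exact fun r => by simpa using hact 0 0
  | add x y _ _ hx hy => exact fun r => by rw [smul_add]; exact hadd _ _ (hx r) (hy r)
  | smul r x _ hx => exact fun r' => by rw [smul_smul]; exact hx _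

variable (hC : IsLocallyProjective R C) (hcop : IsLeftCoproper R C)
  (hN : RMod.IsUnital R S.OpSmash N)
include hC hcop hN

/-- For `n = n' s`, push the tensor of `exists_smashDual_eq` forward along the action on `n'`.
Independence of the presentation of `n` comes for free from separation. -/
lemma exists_coactAct (n : N.carrier) (a : A) : ∃ t : N.carrier ⊗[R] C,
    ∀ f : boxDual R C, evalRight f.1 t = N.smashAct n (a ⊗ₜ f) := by
  induction n using hN.induction with
  | hact n s =>
    obtain ⟨t, ht⟩ := S.exists_smashDual_eq hC hcop s a
    refine ⟨LinearMap.rTensor C (N.smashAct n) t, fun f => ?_⟩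
    rw [evalRight_rTensor, ht, ← smashAct_mul, RightRight.smashMul_eq_smashDual]
  | hadd m n hm hn =>
    obtain ⟨t, ht⟩ := hm
    obtain ⟨u, hu⟩ := hn
    exact ⟨t + u, fun f => by simp only [map_add, LinearMap.add_apply, ht, hu]⟩

/-- The element `∑ n₀ a ⊗ n₁`, characterized by its values under `C^□`. -/
def coactActAux (n : N.carrier) (a : A) : N.carrier ⊗[R] C :=
  (exists_coactAct hC hcop hN n a).choose

lemma evalRight_coactActAux (n : N.carrier) (a : A) (f : boxDual R C) :
    evalRight f.1 (coactActAux hC hcop hN n a) = N.smashAct n (a ⊗ₜ f) :=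
  (exists_coactAct hC hcop hN n a).choose_spec f

/-- `(n, a) ↦ ∑ n₀ a ⊗ n₁` on a unital `A #ᵒᵖ C^□`-module. -/
def coactAct : N.carrier →ₗ[R] A →ₗ[R] N.carrier ⊗[R] C :=
  LinearMap.mk₂ R (coactActAux hC hcop hN)
    (fun m n a => evalRight_separates hC hcop fun f => by
      simp only [map_add, LinearMap.add_apply, evalRight_coactActAux])
    (fun r n a => evalRight_separates hC hcop fun f => by
      simp only [map_smul, LinearMap.smul_apply, evalRight_coactActAux])
    (fun n a b => evalRight_separates hC hcop fun f => by
      simp only [map_add, add_tmul, evalRight_coactActAux])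
    (fun r n a => evalRight_separates hC hcop fun f => by
      simp only [map_smul, ← smul_tmul', evalRight_coactActAux])

lemma evalRight_coactAct (n : N.carrier) (a : A) (f : boxDual R C) :
    evalRight f.1 (coactAct hC hcop hN n a) = N.smashAct n (a ⊗ₜ f) :=
  evalRight_coactActAux hC hcop hN n a f

/-- The defining property of `coactAct` speaks only of `C^□`, but it identifies the tensor with an
explicit one, whose values are known on all of `C*`. This allows evaluation at the counit. -/
lemma evalRight_coactAct_smashAct (n : N.carrier) (s : A ⊗[R] boxDual R C) (a : A)
    (h : Dual R C) : evalRight h (coactAct hC hcop hN (N.smashAct n s) a) =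
      N.smashAct n (S.smashDual s (a ⊗ₜ h)) := by
  obtain ⟨t, ht⟩ := S.exists_smashDual_eq hC hcop s a
  have key : coactAct hC hcop hN (N.smashAct n s) a = LinearMap.rTensor C (N.smashAct n) t :=
    evalRight_separates hC hcop fun f => by
      rw [evalRight_coactAct, evalRight_rTensor, ht, ← smashAct_mul,
        RightRight.smashMul_eq_smashDual]
  rw [key, evalRight_rTensor, ht]

/-- The `A`-action on a unital `A #ᵒᵖ C^□`-module. -/
def algAct : N.carrier →ₗ[R] A →ₗ[R] N.carrier :=
  (coactAct hC hcop hN).compr₂ (evalRight (1 : Dual R C))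

lemma algAct_apply (n : N.carrier) (a : A) :
    algAct hC hcop hN n a = evalRight (1 : Dual R C) (coactAct hC hcop hN n a) := rfl

/-- The action is `(n s) a = n (s a)`, so the module axioms reduce to those of right multiplication
by `A` on `A ⊗ C^□`. -/
lemma algAct_smashAct (n : N.carrier) (s : A ⊗[R] boxDual R C) (a : A) :
    algAct hC hcop hN (N.smashAct n s) a = N.smashAct n (S.smashRight a s) := by
  rw [algAct_apply, evalRight_coactAct_smashAct, RightRight.smashDual_one]

lemma algAct_one (n : N.carrier) : algAct hC hcop hN n 1 = n := by
  induction n using hN.induction with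
  | hact n s => rw [algAct_smashAct, RightRight.smashRight_one]
  | hadd m n hm hn => rw [map_add, LinearMap.add_apply, hm, hn]

lemma algAct_mul (n : N.carrier) (a b : A) : algAct hC hcop hN n (a * b) =
    algAct hC hcop hN (algAct hC hcop hN n a) b := by
  induction n using hN.induction with
  | hact n s => simp only [algAct_smashAct, RightRight.smashRight_mul]
  | hadd m n hm hn => simp only [map_add, LinearMap.add_apply, hm, hn]

/-- The `C`-coaction on a unital `A #ᵒᵖ C^□`-module. -/
def boxCoact : N.carrier →ₗ[R] N.carrier ⊗[R] C := (coactAct hC hcop hN).flip 1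

lemma evalRight_boxCoact (n : N.carrier) (f : boxDual R C) :
    evalRight f.1 (boxCoact hC hcop hN n) = N.smashAct n (1 ⊗ₜ f) :=
  evalRight_coactAct hC hcop hN n 1 f

lemma evalRight_boxCoact_smashAct (n : N.carrier) (s : A ⊗[R] boxDual R C) (h : Dual R C) :
    evalRight h (boxCoact hC hcop hN (N.smashAct n s)) =
      N.smashAct n (S.smashDual s (1 ⊗ₜ h)) :=
  evalRight_coactAct_smashAct hC hcop hN n s 1 h

lemma boxCoact_coassoc (n : N.carrier) :
    TensorProduct.assoc R N.carrier C C (LinearMap.rTensor C (boxCoact hC hcop hN)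
      (boxCoact hC hcop hN n)) =
    LinearMap.lTensor N.carrier Coalgebra.comul (boxCoact hC hcop hN n) := by
  apply (TensorProduct.assoc R N.carrier C C).symm.injective
  rw [LinearEquiv.symm_apply_apply]
  -- Evaluating both `C`-legs turns the left side into `(n (1 # g)) (1 # f)` and the right side into
  -- `n (1 # f ⋆ g)`.
  refine evalRight_separates hC hcop fun g => evalRight_separates hC hcop fun f => ?_
  rw [evalRight_rTensor, evalRight_boxCoact, evalRight_boxCoact, ← smashAct_mul,
    RightRight.smashMul_one_tmul, evalRight_comul]
  exact (evalRight_boxCoact hC hcop hN n (mulBox f.1 g)).symm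

lemma boxCoact_counit (n : N.carrier) :
    LinearMap.lTensor N.carrier Coalgebra.counit (boxCoact hC hcop hN n) = n ⊗ₜ[R] (1 : R) := by
  apply (TensorProduct.rid R N.carrier).injective
  rw [TensorProduct.rid_tmul, one_smul]
  -- Evaluating the coaction at the counit is, by definition, acting by `1 ∈ A`.
  exact algAct_one hC hcop hN n

/-- On `n s`, evaluation at `f` turns both sides into `n` acted on by the extended product of `s`
with `∑ a₀ # (a₁ f)`. -/
lemma boxCoact_algAct (n : N.carrier) (a : A) :
    boxCoact hC hcop hN (algAct hC hcop hN n a) =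
      TensorProduct.map₂ (algAct hC hcop hN) S.coalg.act (boxCoact hC hcop hN n)
        (S.alg.coact a) := by
  induction n using hN.induction with
  | hadd m n hm hn => simp only [map_add, LinearMap.add_apply, hm, hn]
  | hact n s =>
    refine evalRight_separates hC hcop fun f => ?_
    rw [algAct_smashAct, evalRight_boxCoact_smashAct, RightRight.smashDual_smashRight]
    generalize S.alg.coact a = y
    induction y with
    | zero => simp
    | add x y hx hy => simp only [map_add, hx, hy]
    | tmul p q =>
      rw [RRModule.map_evalRight_act, evalRight_boxCoact_smashAct, algAct_smashAct,
        RightRight.smashRight_smashDual, LinearMap.lTensor_tmul, LinearMap.flip_apply]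

/-- The Doi-Koppinen module of a unital `A #ᵒᵖ C^□`-module. -/
def toRRModule : RRModule.{u₁, u₂, u₃, u₄, w} S where
  carrier := N.carrier
  act := algAct hC hcop hN
  act_one := algAct_one hC hcop hN
  act_mul := algAct_mul hC hcop hN
  coact := boxCoact hC hcop hN
  coassoc := boxCoact_coassoc hC hcop hN
  counit := boxCoact_counit hC hcop hN
  compat := boxCoact_algAct hC hcop hN

lemma smashAct_toOpSmash_toRRModule :
    ((toOpSmash S).obj (toRRModule hC hcop hN)).smashAct = N.smashAct := by
  refine LinearMap.ext fun (n : N.carrier) => TensorProduct.ext' fun a f => ?_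
  refine (toOpSmash_smashAct (toRRModule hC hcop hN) n a f).trans ?_
  change algAct hC hcop hN (evalRight f.1 (boxCoact hC hcop hN n)) a = _
  rw [evalRight_boxCoact, algAct_smashAct, RightRight.smashRight_tmul, one_mul]
  rfl

end RMod

/-- Strict isomorphism of categories requires equal objects. Over a common carrier, the action is
the only remaining data. -/
lemma RMod.eq_of_act {T : Type u₂} [NonUnitalRing T] [Module R T] {M : Type w} [AddCommGroup M]
    [Module R M] {α β : M →ₗ[R] T →ₗ[R] M} (h : α = β) (hα hβ) :
    RMod.mk (R := R) (T := T) M α hα = RMod.mk M β hβ := by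
  subst h; rfl

lemma RRModule.eq_of_act_of_coact {M : Type w} [AddCommGroup M]
    [Module R M] {α β : M →ₗ[R] A →ₗ[R] M} {γ δ : M →ₗ[R] M ⊗[R] C} (h : α = β) (h' : γ = δ)
    (a1 a2 a3 a4 a5 b1 b2 b3 b4 b5) :
    RRModule.mk (S := S) M α a1 a2 γ a3 a4 a5 = RRModule.mk M β b1 b2 δ b3 b4 b5 := by
  subst h h'; rfl

section

variable (hC : IsLocallyProjective R C) (hcop : IsLeftCoproper R C)
include hC hcop

lemma toOpSmash_toRRModule {N : RMod.{u₁, max u₁ u₃ u₄, w} R S.OpSmash}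
    (hN : RMod.IsUnital R S.OpSmash N) :
    (toOpSmash S).obj (RMod.toRRModule hC hcop hN) = N := by
  have h := RMod.smashAct_toOpSmash_toRRModule hC hcop hN
  cases N
  exact RMod.eq_of_act h _ _

/-- Both `coactAct` and `∑ m₀ a ⊗ m₁` have value `m (a # f)` at every `f ∈ C^□`, so they coincide.
The action and the coaction are then read off from this tensor. -/
lemma toRRModule_toOpSmash (M : RRModule.{u₁, u₂, u₃, u₄, w} S)
    (hM : RMod.IsUnital R S.OpSmash ((toOpSmash S).obj M)) :
    RMod.toRRModule hC hcop hM = M := by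
  have key : ∀ (m : M.carrier) (a : A), RMod.coactAct hC hcop hM m a =
      LinearMap.rTensor C (M.act.flip a) (M.coact m) := fun m a =>
    evalRight_separates hC hcop fun f =>
      (RMod.evalRight_coactAct hC hcop hM m a f).trans
        ((toOpSmash_smashAct M m a f).trans
          (evalRight_rTensor f.1 (M.act.flip a) (M.coact m)).symm)
  have hact : RMod.algAct hC hcop hM = M.act := LinearMap.ext₂ fun (m : M.carrier) a =>
    (congrArg (evalRight (1 : Dual R C)) (key m a)).trans
      ((evalRight_rTensor 1 (M.act.flip a) (M.coact m)).trans
        (congrArg (M.act · a) (M.evalRight_counit m)))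
  have hcoact : RMod.boxCoact hC hcop hM = M.coact := LinearMap.ext fun (m : M.carrier) =>
    (key m 1).trans (by
      rw [show M.act.flip 1 = LinearMap.id from LinearMap.ext M.act_one, LinearMap.rTensor_id,
        LinearMap.id_apply]
      rfl)
  cases M
  exact RRModule.eq_of_act_of_coact hact hcoact _ _ _ _ _ _ _ _ _ _

lemma toOpSmash_obj_injective :
    Function.Injective (toOpSmash.{u₁, u₂, u₃, u₄, w} S).obj := by
  intro M M' h
  -- The left inverse takes a unitality proof as an argument, so the equality of objects is
  -- transported with both proofs generalized.
  have key : ∀ (N N' : RMod.{u₁, max u₁ u₃ u₄, w} R S.OpSmash)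
      (hN : RMod.IsUnital R S.OpSmash N) (hN' : RMod.IsUnital R S.OpSmash N'), N = N' →
      RMod.toRRModule hC hcop hN = RMod.toRRModule hC hcop hN' := by
    rintro N _ hN hN' rfl; rfl
  rw [← toRRModule_toOpSmash hC hcop M (toOpSmash_isUnital hcop M),
    ← toRRModule_toOpSmash hC hcop M' (toOpSmash_isUnital hcop M')]
  exact key _ _ _ _ h

lemma toOpSmash_isIsoOnto :
    IsIsoOnto (toOpSmash.{u₁, u₂, u₃, u₄, w} S) (RMod.IsUnital R S.OpSmash) where
  full := toOpSmash_full hC hcop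
  faithful := inferInstance
  injective := toOpSmash_obj_injective hC hcop
  mem_iff N := ⟨fun hN => ⟨_, toOpSmash_toRRModule hC hcop hN⟩, by
    rintro ⟨M, rfl⟩; exact toOpSmash_isUnital hcop M⟩

end

end Reconstruction

section BoxLeftDual

variable {R : Type u₁} {H : Type u₂} {A : Type u₃} {C : Type u₄} [CommRing R]
  [Ring H] [Bialgebra R H] [Ring A] [Algebra R A] [AddCommGroup C] [Module R C] [Coalgebra R C]
  {S : RightRight R H A C}

namespace RightRight

/-! ### The image of `A #ᵒᵖ C^□` in `^□𝒞` -/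

lemma LeftDual.apply_tmul (g : S.LeftDual) (a : A) (c : C) : g (a ⊗ₜ c) = a * g (1 ⊗ₜ c) := by
  rw [← g.map_smul_left, TensorProduct.smul_tmul', smul_eq_mul, mul_one]

lemma contract_smashToLeftDual (a : A) (f : boxDual R C) (c : C) :
    contract (S.smashToLeftDual (a ⊗ₜ f)) (S.coringComul (1 ⊗ₜ c)) =
      S.coringAct (1 ⊗ₜ evalRight f.1 (Coalgebra.comul c)) a := by
  rw [coringComul_one_tmul]
  generalize Coalgebra.comul (R := R) c = s
  induction s with
  | zero => simp
  | add x y hx hy => simp only [map_add, hx, hy, tmul_add, LinearMap.add_apply]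
  | tmul x y => simp [smashToLeftDual_tmul]

variable (S) in
/-- The counit `a ⊗ c ↦ a ε(c)` of `𝒞`, the unit of `*𝒞`. -/
def coringCounit : S.LeftDual :=
  show A ⊗[R] C →ₗ[A] A from TensorProduct.AlgebraTensorModule.lift
    (LinearMap.toSpanSingleton A (C →ₗ[R] A)
      (LinearMap.toSpanSingleton R A 1 ∘ₗ Coalgebra.counit))

lemma coringCounit_tmul (a : A) (c : C) :
    S.coringCounit (a ⊗ₜ c) = a * (Coalgebra.counit (R := R) c • (1 : A)) := rfl

/-- Right `A`-linearity of the counit combines `ε(c h) = ε(c) ε(h)` with the counit axiom of the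
comodule algebra `A`. -/
lemma coringCounit_coringAct (d : A ⊗[R] C) (a : A) :
    S.coringCounit (S.coringAct d a) = S.coringCounit d * a := by
  induction d with
  | zero => simp
  | add x y hx hy => simp only [map_add, LinearMap.add_apply, hx, hy, add_mul]
  | tmul b c =>
    have e : ∀ y : A ⊗[R] H,
        S.coringCounit (TensorProduct.map (LinearMap.mulLeft R b) (S.coalg.act c) y) =
        Coalgebra.counit (R := R) c •
          (b * TensorProduct.rid R A (LinearMap.lTensor A Coalgebra.counit y)) := by
      intro y
      induction y with
      | zero => simp
      | add x y hx hy => simp only [map_add, hx, hy, mul_add, smul_add]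
      | tmul p q => simp [coringCounit_tmul, S.coalg.counit_act, mul_smul]
    rw [coringAct_tmul, e, S.alg.counit, coringCounit_tmul]
    simp

lemma mul_coringCounit (f : S.LeftDual) : f * S.coringCounit = f := by
  refine LeftDual.ext fun c => ?_
  rw [LeftDual.mul_apply, coringComul_one_tmul]
  have e : ∀ s : C ⊗[R] C, S.coringCounit (contract f (TensorProduct.map
      (TensorProduct.mk R A C 1) (TensorProduct.mk R A C 1) s)) =
      f (1 ⊗ₜ TensorProduct.lid R C (LinearMap.rTensor C Coalgebra.counit s)) := by
    intro s
    induction s with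
    | zero => simp
    | add x y hx hy => simp only [map_add, hx, hy, tmul_add]
    | tmul x y =>
      simp [coringCounit_coringAct, coringCounit_tmul, LeftDual.map_smul_R]
  rw [e, Coalgebra.rTensor_counit_comul, TensorProduct.lid_tmul, one_smul]

/-- By left `A`-linearity, only the values at `1 ⊗ c` count, for `c` among the `C`-legs of `d`. -/
lemma exists_finset_apply_eq (d : A ⊗[R] C) : ∃ F : Finset C, ∀ g g' : S.LeftDual,
    (∀ c ∈ F, g (1 ⊗ₜ c) = g' (1 ⊗ₜ c)) → g d = g' d := by
  classical
  obtain ⟨P, rfl⟩ := TensorProduct.exists_finset d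
  refine ⟨P.image Prod.snd, fun g g' h => ?_⟩
  rw [map_sum, map_sum]
  refine Finset.sum_congr rfl fun p hp => ?_
  rw [g.apply_tmul, g'.apply_tmul, h _ (Finset.mem_image_of_mem _ hp)]

lemma exists_finset_leftDualEval_eq (t : S.LeftDual ⊗[R] (A ⊗[R] C)) :
    ∃ F : Finset C, ∀ g g' : S.LeftDual, (∀ c ∈ F, g (1 ⊗ₜ c) = g' (1 ⊗ₜ c)) →
      leftDualEval g t = leftDualEval g' t := by
  classical
  induction t with
  | zero => exact ⟨∅, by simp⟩
  | add x y hx hy =>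
    obtain ⟨F, hF⟩ := hx
    obtain ⟨F', hF'⟩ := hy
    refine ⟨F ∪ F', fun g g' h => ?_⟩
    rw [map_add, map_add, hF g g' fun c hc => h c (Finset.mem_union_left _ hc),
      hF' g g' fun c hc => h c (Finset.mem_union_right _ hc)]
  | tmul f d =>
    obtain ⟨F, hF⟩ := S.exists_finset_apply_eq d
    refine ⟨F, fun g g' h => DFunLike.ext _ _ fun x => ?_⟩
    rw [leftDualEval_tmul, leftDualEval_tmul, hF g g' h]

section

variable (hC : IsLocallyProjective R C) (hcop : IsLeftCoproper R C)
include hC hcop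

/-- At `1 ⊗ c`, the product `(a # f) ⋆ g` is `g((1 ⊗ ∑ f(c₂) c₁) a)`. Rationality of `f` rewrites
the inner sum as `∑ fᵢ(c) cᵢ`, which separates the dependence on `c` from the argument of `g`. -/
lemma smashToLeftDual_mem (s : A ⊗[R] boxDual R C) : S.smashToLeftDual s ∈ S.boxLeftDual := by
  induction s with
  | zero => rw [map_zero]; exact zero_mem _
  | add x y hx hy => rw [map_add]; exact add_mem hx hy
  | tmul a f =>
    obtain ⟨t, ht⟩ := exists_mulBox_eq hC hcop f
    -- `∑ f(c₂) c₁ = ∑ fᵢ(c) cᵢ`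
    let u : C → boxDual R C ⊗[R] C →ₗ[R] C := fun c =>
      TensorProduct.lift ((LinearMap.lsmul R C) ∘ₗ (LinearMap.applyₗ c ∘ₗ
        (WithConv.linearEquiv R (C →ₗ[R] R)).toLinearMap ∘ₗ (boxDual R C).subtype))
    have hu : ∀ c (g : boxDual R C) x, u c (g ⊗ₜ x) = g.1 c • x := fun _ _ _ => rfl
    have hcomul : ∀ c, evalRight f.1 (Coalgebra.comul c) = u c t := by
      -- Applying `h` to either side gives `(h ⋆ f)(c) = ∑ h(cᵢ) fᵢ(c)`.
      refine fun c => boxDual_separates hC hcop fun h => ?_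
      rw [← dual_mul_apply, ← coe_mulBox, ht]
      generalize t = z
      induction z with
      | zero =>
        rw [map_zero, map_zero]
        exact (h.1.ofConv.map_zero).symm
      | add x y hx hy => rw [map_add, map_add, Dual.map_add, ← hx, ← hy]; rfl
      | tmul x y => rw [evalRight_tmul, hu, Dual.map_smul, mul_comm]; rfl
    have key : ∀ y : A ⊗[R] H, ∃ T : S.LeftDual ⊗[R] (A ⊗[R] C), ∀ (g : S.LeftDual) (c : C),
        g (TensorProduct.map₂ (LinearMap.mul R A) S.coalg.act (1 ⊗ₜ u c t) y) =
          leftDualEval g T (1 ⊗ₜ c) := by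
      intro y
      induction y with
      | zero => exact ⟨0, by simp⟩
      | add x y hx hy =>
        obtain ⟨T, hT⟩ := hx
        obtain ⟨U, hU⟩ := hy
        exact ⟨T + U, fun g c => by simp only [map_add, LeftDual.add_apply, hT, hU]⟩
      | tmul p q =>
        -- For a term `p ⊗ q` of the coaction of `a`, the witness is `∑ (p # fᵢ) ⊗ (1 ⊗ cᵢ q)`.
        refine ⟨TensorProduct.map (S.smashToLeftDual ∘ₗ TensorProduct.mk R A (boxDual R C) p)
          (TensorProduct.mk R A C 1 ∘ₗ S.coalg.act.flip q) t, fun g c => ?_⟩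
        generalize t = z
        induction z with
        | zero => simp
        | add x y hx hy =>
          simp only [map_add, tmul_add, LinearMap.add_apply, LeftDual.add_apply, hx, hy]
        | tmul x y =>
          rw [hu, TensorProduct.map_tmul, leftDualEval_tmul]
          simp [smashToLeftDual_tmul, LeftDual.apply_tmul g p, LeftDual.map_smul_R]
    obtain ⟨T, hT⟩ := key (S.alg.coact a)
    refine ⟨T, fun g => LeftDual.ext fun c => ?_⟩
    rw [LeftDual.mul_apply, contract_smashToLeftDual, hcomul, coringAct_apply, hT]

/-- On a finite set, elements of `*𝒞` agree with elements of `A #ᵒᵖ C^□`. -/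
lemma exists_smashToLeftDual_apply_eq (g : S.LeftDual) (F : Finset C) :
    ∃ s : A ⊗[R] boxDual R C, ∀ c ∈ F, g (1 ⊗ₜ c) = S.smashToLeftDual s (1 ⊗ₜ c) := by
  obtain ⟨E, f, hf⟩ := exists_dual_basis hC hcop F
  -- Interpolation of `g` by a dual basis of `F`.
  refine ⟨∑ e ∈ E, g (1 ⊗ₜ e) ⊗ₜ f e, fun c hc => ?_⟩
  have h : ∀ x : Finset C, (∑ e ∈ x, S.smashToLeftDual (g (1 ⊗ₜ e) ⊗ₜ f e)) (1 ⊗ₜ c) =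
      ∑ e ∈ x, S.smashToLeftDual (g (1 ⊗ₜ e) ⊗ₜ f e) (1 ⊗ₜ c) := by
    classical
    intro x
    induction x using Finset.induction_on with
    | empty => simp
    | insert a s ha ih => rw [Finset.sum_insert ha, Finset.sum_insert ha, LeftDual.add_apply, ih]
  rw [map_sum, h]
  conv_lhs => rw [← hf c hc, TensorProduct.tmul_sum, map_sum]
  refine Finset.sum_congr rfl fun e _ => ?_
  rw [smashToLeftDual_tmul, one_mul, TensorProduct.tmul_smul, LeftDual.map_smul_R]

/-- Right multiplication of an element of `^□𝒞` by an element of `*𝒞` agrees with right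
multiplication by some element of `A #ᵒᵖ C^□`. -/
lemma exists_mul_eq_mul_smashToLeftDual {f : S.LeftDual} (hf : f ∈ S.boxLeftDual)
    (g : S.LeftDual) : ∃ s : A ⊗[R] boxDual R C, f * g = f * S.smashToLeftDual s := by
  obtain ⟨t, ht⟩ := hf
  obtain ⟨F, hF⟩ := exists_finset_leftDualEval_eq t
  obtain ⟨s, hs⟩ := exists_smashToLeftDual_apply_eq hC hcop g F
  exact ⟨s, by rw [ht, ht, hF _ _ hs]⟩

/-- The ring morphism `A #ᵒᵖ C^□ → ^□𝒞`. -/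
def smashToBox : A ⊗[R] boxDual R C →ₗ[R] S.boxLeftDual :=
  S.smashToLeftDual.codRestrict S.boxLeftDual.toSubmodule (smashToLeftDual_mem hC hcop)

lemma smashToBox_mul (s t : A ⊗[R] boxDual R C) :
    smashToBox (S := S) hC hcop (S.smashMul s t) = smashToBox hC hcop s * smashToBox hC hcop t :=
  Subtype.ext (smashToLeftDual_mul s t)

lemma exists_mul_eq_mul_smashToBox (f g : S.boxLeftDual) :
    ∃ s, f * g = f * smashToBox hC hcop s := by
  obtain ⟨s, hs⟩ := exists_mul_eq_mul_smashToLeftDual hC hcop f.2 g.1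
  exact ⟨s, Subtype.ext hs⟩

/-- Write `f = f ⋆ ε` and replace the counit `ε` of `𝒞`, which need not lie in `^□𝒞`, by an element
of the image. -/
lemma exists_eq_mul_smashToBox (f : S.boxLeftDual) : ∃ s, f = f * smashToBox hC hcop s := by
  obtain ⟨s, hs⟩ := exists_mul_eq_mul_smashToLeftDual hC hcop f.2 S.coringCounit
  exact ⟨s, Subtype.ext ((mul_coringCounit f.1).symm.trans hs)⟩

end

end RightRight

/-! ### Doi-Koppinen modules as `^□𝒞`-modules -/

variable (hC : IsLocallyProjective R C) (hcop : IsLeftCoproper R C)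
include hC hcop

/-- Restriction of scalars along `A #ᵒᵖ C^□ → ^□𝒞`. -/
def RMod.restrictSmash (N : RMod.{u₁, max u₃ u₄, w} R S.boxLeftDual) :
    RMod.{u₁, max u₁ u₃ u₄, w} R S.OpSmash where
  carrier := N.carrier
  act := N.act.compl₂ (RightRight.smashToBox hC hcop)
  act_mul m s t := (congrArg (N.act m) (RightRight.smashToBox_mul hC hcop s t)).trans
    (N.act_mul m _ _)

/-- A product `m f` equals `(m f) s` once `f = f s` with `s` from `A #ᵒᵖ C^□`. -/
lemma RMod.restrictSmash_isUnital {N : RMod.{u₁, max u₃ u₄, w} R S.boxLeftDual}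
    (hN : RMod.IsUnital R S.boxLeftDual N) :
    RMod.IsUnital R S.OpSmash (N.restrictSmash hC hcop) := by
  refine eq_top_iff.2 ((eq_top_iff.1 hN).trans (Submodule.span_mono ?_))
  rintro _ ⟨m, f, rfl⟩
  obtain ⟨s, hs⟩ := RightRight.exists_eq_mul_smashToBox hC hcop f
  refine ⟨N.act m f, s, ?_⟩
  conv_rhs => rw [hs, N.act_mul]
  rfl

lemma toBoxDual_isUnital (M : RRModule.{u₁, u₂, u₃, u₄, w} S) :
    RMod.IsUnital R S.boxLeftDual ((toBoxDual S).obj M) := by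
  refine eq_top_iff.2 ((eq_top_iff.1 (toOpSmash_isUnital hcop M)).trans (Submodule.span_mono ?_))
  rintro _ ⟨m, s, rfl⟩
  exact ⟨m, RightRight.smashToBox hC hcop s, rfl⟩

/-- The two `^□𝒞`-actions agree on the image of `A #ᵒᵖ C^□`. On a vector `n s`, any `f` can be
traded for an element `t` of that image with `s f = s t`, and such vectors generate `N` by unitality
of the restriction. -/
lemma toBoxDual_toRRModule_act {N : RMod.{u₁, max u₃ u₄, w} R S.boxLeftDual}
    (hN : RMod.IsUnital R S.boxLeftDual N) :
    ((toBoxDual S).obj (RMod.toRRModule hC hcop (N.restrictSmash_isUnital hC hcop hN))).act =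
      N.act := by
  let M := RMod.toRRModule hC hcop (N.restrictSmash_isUnital hC hcop hN)
  have hsmash : ∀ (n : N.carrier) s, M.dualAction n (S.smashToLeftDual s) =
      N.act n (RightRight.smashToBox hC hcop s) := fun n s =>
    LinearMap.congr_fun₂ (RMod.smashAct_toOpSmash_toRRModule hC hcop
      (N.restrictSmash_isUnital hC hcop hN)) n s
  have hmul : ∀ (n : N.carrier) s (f : S.boxLeftDual),
      M.dualAction (N.act n (RightRight.smashToBox hC hcop s)) f.1 =
        N.act (N.act n (RightRight.smashToBox hC hcop s)) f := by
    intro n s f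
    obtain ⟨t, ht⟩ := RightRight.exists_mul_eq_mul_smashToBox hC hcop
      (RightRight.smashToBox hC hcop s) f
    rw [← N.act_mul, ht, N.act_mul]
    exact (congrArg (M.dualAction · f.1) (hsmash n s).symm).trans
      ((M.dualAction_mul n _ f.1).symm.trans
        ((congrArg (M.dualAction n) (congrArg Subtype.val ht)).trans
          ((M.dualAction_mul n _ _).trans
            ((congrArg (M.dualAction · _) (hsmash n s)).trans (hsmash _ t)))))
  refine LinearMap.ext₂ fun (n : N.carrier) f => ?_
  change M.dualAction n f.1 = N.act n f
  induction n using (N.restrictSmash_isUnital hC hcop hN).induction with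
  | hadd m n hm hn =>
    exact (LinearMap.map_add₂ M.dualAction m n f.1).trans
      ((congrArg₂ (· + ·) hm hn).trans (LinearMap.map_add₂ N.act m n f).symm)
  | hact n s => exact hmul n s f

lemma toBoxDual_toRRModule {N : RMod.{u₁, max u₃ u₄, w} R S.boxLeftDual}
    (hN : RMod.IsUnital R S.boxLeftDual N) :
    (toBoxDual S).obj (RMod.toRRModule hC hcop (N.restrictSmash_isUnital hC hcop hN)) = N := by
  have h := toBoxDual_toRRModule_act hC hcop hN
  cases N
  exact RMod.eq_of_act h _ _

lemma toBoxDual_isIsoOnto :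
    IsIsoOnto (toBoxDual.{u₁, u₂, u₃, u₄, w} S) (RMod.IsUnital R S.boxLeftDual) where
  full :=
    { map_surjective := fun {M M'} φ => by
        have := toOpSmash_full (S := S) hC hcop
        let φ' : M.carrier →ₗ[R] M'.carrier := RMod.Hom.toLin φ
        -- A `^□𝒞`-linear map is `A #ᵒᵖ C^□`-linear by restriction, so fullness is inherited from
        -- `toOpSmash`.
        let ψ : (toOpSmash S).obj M ⟶ (toOpSmash S).obj M' :=
          ⟨φ', fun m s => RMod.Hom.map_act φ m (RightRight.smashToBox hC hcop s)⟩
        obtain ⟨χ, hχ⟩ := (toOpSmash S).map_surjective ψ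
        have hlin : RRModule.Hom.toLin χ = φ' := congrArg RMod.Hom.toLin hχ
        exact ⟨χ, RMod.Hom.ext hlin⟩ }
  faithful := ⟨fun h => RRModule.Hom.ext (congrArg RMod.Hom.toLin h)⟩
  -- Restricting `toBoxDual` along `smashToBox` gives back `toOpSmash` definitionally.
  injective M M' h := toOpSmash_obj_injective hC hcop
    (congrArg (RMod.restrictSmash hC hcop) h)
  mem_iff N := ⟨fun hN => ⟨_, toBoxDual_toRRModule hC hcop hN⟩, by
    rintro ⟨M, rfl⟩; exact toBoxDual_isUnital hC hcop M⟩

end BoxLeftDual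

/-! ### The left-right case -/

section LeftRightCase

variable {R : Type u₁} {H : Type u₂} {A : Type u₃} {C : Type u₄} [CommRing R]
  [Ring H] [Bialgebra R H] [Ring A] [Algebra R A] [AddCommGroup C] [Module R C] [Coalgebra R C]

lemma RMod.opFunctor_isIsoOnto (T : Type u₂) [NonUnitalRing T] [Module R T] :
    IsIsoOnto (RMod.opFunctor.{u₁, u₂, w} R T) ⊤ where
  full := ⟨fun φ => ⟨⟨LMod.Hom.toLin φ, fun m t => LMod.Hom.map_act φ (MulOpposite.op t) m⟩, rfl⟩⟩
  faithful := ⟨fun h => RMod.Hom.ext (congrArg LMod.Hom.toLin h)⟩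
  injective := by
    let G : LMod.{u₁, u₂, w} R Tᵐᵒᵖ → RMod.{u₁, u₂, w} R T := fun N =>
      { carrier := N.carrier
        act := (N.act ∘ₗ (MulOpposite.opLinearEquiv R).toLinearMap).flip
        act_mul := fun m s t => N.mul_act (MulOpposite.op t) (MulOpposite.op s) m }
    have hG : Function.LeftInverse G (RMod.opFunctor.{u₁, u₂, w} R T).obj := fun M => rfl
    exact hG.injective
  mem_iff N := ⟨fun _ => ⟨
      { carrier := N.carrier
        act := (N.act ∘ₗ (MulOpposite.opLinearEquiv R).toLinearMap).flip
        act_mul := fun m s t => N.mul_act (MulOpposite.op t) (MulOpposite.op s) m }, rfl⟩,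
    fun _ => trivial⟩

lemma RMod.isUnital_opFunctor {T : Type u₂} [NonUnitalRing T] [Module R T]
    (M : RMod.{u₁, u₂, w} R T) :
    LMod.IsUnital R Tᵐᵒᵖ ((RMod.opFunctor R T).obj M) ↔ RMod.IsUnital R T M := by
  have h : {x | ∃ t m, ((RMod.opFunctor R T).obj M).act t m = x} =
      {x | ∃ m t, M.act m t = x} := by
    ext x
    exact ⟨fun ⟨t, m, e⟩ => ⟨m, t.unop, e⟩, fun ⟨m, t, e⟩ => ⟨MulOpposite.op t, m, e⟩⟩
  exact Eq.to_iff (congrArg (fun s => Submodule.span R s = ⊤) h)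

/-- A right-right Doi-Koppinen module over `(Hᵒᵖ, Aᵒᵖ, C)` is a left-right one over
`(H, A, C)`. -/
def LRModule.ofOp {S : LeftRight R H A C} (M : RRModule.{u₁, u₂, u₃, u₄, w} S.op) :
    LRModule.{u₁, u₂, u₃, u₄, w} S where
  carrier := M.carrier
  act := M.act.flip ∘ₗ (MulOpposite.opLinearEquiv R).toLinearMap
  one_act m := M.act_one m
  mul_act a b m := M.act_mul m (MulOpposite.op b) (MulOpposite.op a)
  coact := M.coact
  coassoc := M.coassoc
  counit := M.counit
  compat a m := by
    refine (M.compat m (MulOpposite.op a)).trans ?_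
    change TensorProduct.map₂ _ _ _ (opMap R A H (S.alg.coact a)) = _
    generalize S.alg.coact a = x
    generalize M.coact m = y
    induction x with
    | zero => simp
    | add x x' hx hx' => simp only [map_add, hx, hx', LinearMap.add_apply]
    | tmul a h =>
      induction y with
      | zero => simp
      | add y y' hy hy' => simp only [map_add, hy, hy', LinearMap.add_apply]
      | tmul b k => simp [LeftRight.op, LeftModuleCoalgebra.op]

/-- `LRModule.ofOp` is inverse on objects by definitional unfolding, since only the order of
arguments and the `op` wrappers change. -/
lemma LRModule.opFunctor_isIsoOnto (S : LeftRight R H A C) :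
    IsIsoOnto (LRModule.opFunctor.{u₁, u₂, u₃, u₄, w} S) ⊤ where
  full := ⟨fun φ => ⟨⟨RRModule.Hom.toLin φ,
    fun a m => RRModule.Hom.map_act φ m (MulOpposite.op a), RRModule.Hom.map_coact φ⟩, rfl⟩⟩
  faithful := ⟨fun h => LRModule.Hom.ext (congrArg RRModule.Hom.toLin h)⟩
  injective := by
    have h : Function.LeftInverse LRModule.ofOp (LRModule.opFunctor.{u₁, u₂, u₃, u₄, w} S).obj :=
      fun M => rfl
    exact h.injective
  mem_iff M := ⟨fun _ => ⟨LRModule.ofOp M, rfl⟩, fun _ => trivial⟩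

variable (hC : IsLocallyProjective R C) (hcop : IsLeftCoproper R C) (S : LeftRight R H A C)
include hC hcop

lemma toSmash_isIsoOnto :
    IsIsoOnto (toSmash.{u₁, u₂, u₃, u₄, w} S) (LMod.IsUnital R S.Smash) :=
  (LRModule.opFunctor_isIsoOnto S).precomp
    ((toOpSmash_isIsoOnto hC hcop).comp (RMod.opFunctor_isIsoOnto _) RMod.isUnital_opFunctor)

lemma toBoxDualOp_isIsoOnto :
    IsIsoOnto (toBoxDualOp.{u₁, u₂, u₃, u₄, w} S) (LMod.IsUnital R (S.op.boxLeftDual)ᵐᵒᵖ) :=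
  (LRModule.opFunctor_isIsoOnto S).precomp
    ((toBoxDual_isIsoOnto hC hcop).comp (RMod.opFunctor_isIsoOnto _) RMod.isUnital_opFunctor)

end LeftRightCase

end

end DoiKoppinen

theorem mainTheorem12
    {R : Type u₁} {H : Type u₂} {A : Type u₃} {C : Type u₄} [CommRing R]
    [Ring H] [Bialgebra R H] [Ring A] [Algebra R A]
    [AddCommGroup C] [Module R C] [Coalgebra R C]
    (hC : DoiKoppinen.IsLocallyProjective R C)
    (hcop : DoiKoppinen.IsLeftCoproper R C)
    (hpure : DoiKoppinen.IsBoxPure R C A) :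
    (∀ S : DoiKoppinen.RightRight R H A C,
      (∃ h : ∀ M : DoiKoppinen.RRModule.{u₁, u₂, u₃, u₄, w} S,
          DoiKoppinen.RMod.IsUnital R S.OpSmash ((DoiKoppinen.toOpSmash S).obj M),
        DoiKoppinen.IsIsoOfCategories
          ((DoiKoppinen.RMod.IsUnital R S.OpSmash).lift (DoiKoppinen.toOpSmash S) h)) ∧
      (∃ h : ∀ M : DoiKoppinen.RRModule.{u₁, u₂, u₃, u₄, w} S,
          DoiKoppinen.RMod.IsUnital R S.boxLeftDual ((DoiKoppinen.toBoxDual S).obj M),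
        DoiKoppinen.IsIsoOfCategories
          ((DoiKoppinen.RMod.IsUnital R S.boxLeftDual).lift (DoiKoppinen.toBoxDual S) h))) ∧
    (∀ S : DoiKoppinen.LeftRight R H A C,
      (∃ h : ∀ M : DoiKoppinen.LRModule.{u₁, u₂, u₃, u₄, w} S,
          DoiKoppinen.LMod.IsUnital R S.Smash ((DoiKoppinen.toSmash S).obj M),
        DoiKoppinen.IsIsoOfCategories
          ((DoiKoppinen.LMod.IsUnital R S.Smash).lift (DoiKoppinen.toSmash S) h)) ∧
      (∃ h : ∀ M : DoiKoppinen.LRModule.{u₁, u₂, u₃, u₄, w} S,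
          DoiKoppinen.LMod.IsUnital R (S.op.boxLeftDual)ᵐᵒᵖ
            ((DoiKoppinen.toBoxDualOp S).obj M),
        DoiKoppinen.IsIsoOfCategories
          ((DoiKoppinen.LMod.IsUnital R (S.op.boxLeftDual)ᵐᵒᵖ).lift
            (DoiKoppinen.toBoxDualOp S) h))) := by
  exact ⟨fun S => ⟨(DoiKoppinen.toOpSmash_isIsoOnto hC hcop).exists_lift,
      (DoiKoppinen.toBoxDual_isIsoOnto hC hcop).exists_lift⟩,
    fun S => ⟨(DoiKoppinen.toSmash_isIsoOnto hC hcop S).exists_lift,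
      (DoiKoppinen.toBoxDualOp_isIsoOnto hC hcop S).exists_lift⟩⟩
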